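/- **Setting.** A semi-infinitely constrained Markov decision process (SICMDP) is a tuple $M=\langle \mathcal S,\mathcal A,Y,P,r,c,u,\mu,\gamma\rangle$ with finite sets $\mathcal S,\mathcal A$ of states and actions, a compact $Y\subset\mathbb R^k$, transition probabilities $P(s'|s,a)$, reward $r:\mathcal S\times\mathcal A\to[0,1]$, costs $c_y:\mathcal S\times\mathcal A\to[0,1]$ and bounds $u_y\in\mathbb R$ ($y\in Y$), initial distribution $\mu$ and discount factor $\gamma\in[0,1)$. For a stationary randomized policy $\pi$ put $V_f^{\pi}(\mu)=\mathbb E\big[\sum_{t\ge0}\gamma^t f(s_t,a_t)\big]$. Assume that the problem $\max_\pi V_r^\pi(\mu)$ subject to $V_{c_y}^\pi(\mu)\le u_y$ for all $y\in Y$ has an optimal policy $\pi^*$. **SI-CRL.** From a dataset of transitions let $n(s,a,s')$ and $n(s,a)$ be the numbers of occurrences of $(s,a,s')$ and $(s,a)$, let $\widehat P(s'|s,a)=n(s,a,s')/\max(1,n(s,a))$ and, for a confidence parameter $\delta'$, $$d_{\delta'}(s,a,s')=\min\Big\{\sqrt{\tfrac{2\widehat P(s'|s,a)(1-\widehat P(s'|s,a))\log(4/\delta')}{n(s,a,s')}}+\tfrac{4\log(4/\delta')}{n(s,a,s')},\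 \sqrt{\tfrac{\log(2/\delta')}{2n(s,a,s')}}\Big\}$$ (with $d_{\delta'}=\infty$ if $n(s,a,s')=0$). Let $M_{\delta'}$ be the set of SICMDPs that differ from $M$ at most in the transition probabilities $P'$, which satisfy $|P'(s'|s,a)-\widehat P(s'|s,a)|\le d_{\delta'}(s,a,s')$ for all $s,a,s'$ and vanish outside the next states that are known a priori to be the only possible ones. The optimistic problem is to maximize $V_r^{\pi,M'}(\mu)$ over $M'\in M_{\delta'}$ and policies $\pi$, subject to $V_{c_y}^{\pi,M'}(\mu)\le u_y$ for all $y\in Y$. SI-CRL returns the policy of a solution. **Modification.** Number the states $0,\dots,|\mathcal S|-1$ in any way and let $d=\max(1,\lceil\log_2|\mathcal S|\rceil)$. The transformed SICMDP $\bar M$ has, besides the states in $\mathcal S$, for each $(s,a)$ one state for each non-empty block $\{s':\lfloor \mathrm{number}(s')/2^{d-k}\rfloor=j\}$, $0<k<d$; these are the inner vertices of a binary tree of depth $d$ whose root is $s$ (when $a$ is played) and whose leaves are the states in $\mathcal S$. From a vertex of the tree of $(s,a)$ one moves to a child, with the conditional probability that $s'\sim P(\cdot|s,a)$ lies below that child given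 that it lies below the vertex (given a vertex of probability zero, use the uniform distribution on the leaves below it). Hence at most two next states are possible, and they are known. In added states the action has no effect and rewards, costs and initial probabilities vanish; $Y$ and $u$ are unchanged and the discount factor is $\gamma^{1/d}$. A sample $(s,a,s')$ becomes the $d$ transitions on the path from $s$ to $s'$ in the tree of $(s,a)$; those from added states are recorded once for each action. The modified SI-CRL runs SI-CRL on $\bar M$ and the transformed dataset, with known possible next states the children in the tree and confidence parameter $\delta'=\delta/(2|\mathcal S|^4|\mathcal A|^3)$, and returns the restriction to $\mathcal S$ of the policy obtained. The optimistic problem is solved exactly whenever it is feasible (any solution may be chosen); otherwise an arbitrary policy is returned. **Theorem.** There is a universal constant $C>0$ such that the following holds for every SICMDP $M$ as above, every numbering of $\mathcal S$, all $\epsilon,\delta>0$ and every probability distribution $\nu$ on $\mathcal S\times\mathcal A$ with $\nu(s,a)>0$ for all $(s,a)$; write $\nu_{\min}=\min_{\nu(s,a)>0}\nu(s,a)$. If the dataset consists of $m$ independent samples $(s_i,a_i,s_i')$ with $(s_i,a_i)\sim\nu$, $s_i'\sim P(\cdot|s_i,a_i)$ and $$m\ \ge\ C\,\frac{|\mathcal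 S||\mathcal A|(\log|\mathcal S|)^3\log\big(8|\mathcal S|^4|\mathcal A|^3/\delta\big)}{\nu_{\min}\,\epsilon^2(1-\gamma)^3},$$ then the modified SI-CRL is $(\epsilon,\delta)$-optimal: with probability at least $1-\delta$ it returns a policy $\pi$ with $$V_r^{\pi^*}(\mu)-V_r^{\pi}(\mu)\le\epsilon\qquad\text{and}\qquad V_{c_y}^{\pi}(\mu)-u_y\le\epsilon\quad\text{for all }y\in Y.$$ -/

import Mathlib

/-- A semi-infinitely constrained Markov decision process with finite state space `S`, finite
action space `A`, and constraints indexed by a compact set `Y ⊆ ℝ^dim`. -/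
structure SICMDP (S A : Type*) [Fintype S] [Fintype A] (dim : ℕ) where
  /-- index set of the constraints -/
  Y : Set (Fin dim → ℝ)
  isCompact_Y : IsCompact Y
  /-- transition probabilities: `P s a s'` is the probability of moving to `s'` from `(s, a)` -/
  P : S → A → S → ℝ
  P_mem : ∀ s a, P s a ∈ stdSimplex ℝ S
  /-- reward -/
  r : S → A → ℝ
  r_mem : ∀ s a, r s a ∈ Set.Icc (0 : ℝ) 1
  /-- costs -/
  c : (Fin dim → ℝ) → S → A → ℝ
  c_mem : ∀ y ∈ Y, ∀ s a, c y s a ∈ Set.Icc (0 : ℝ) 1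
  /-- bounds of the constraints -/
  u : (Fin dim → ℝ) → ℝ
  /-- initial distribution -/
  μ : S → ℝ
  μ_mem : μ ∈ stdSimplex ℝ S
  /-- discount factor -/
  γ : ℝ
  γ_nonneg : 0 ≤ γ
  γ_lt_one : γ < 1

/-- Stationary (randomized) policies: `π s a` is the probability of playing `a` in state `s`. -/
def IsPolicy {S A : Type*} [Fintype A] (π : S → A → ℝ) : Prop :=
  ∀ s, π s ∈ stdSimplex ℝ A

/-- The law of the state `s_t` of the chain started from `μ`, with transitions `P` and actions
drawn from the policy `π`. -/
def stateLaw {S A : Type*} [Fintype S] [Fintype A] (μ : S → ℝ) (P : S → A → S → ℝ)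
    (π : S → A → ℝ) : ℕ → S → ℝ
  | 0 => μ
  | t + 1 => fun s' => ∑ s, ∑ a, stateLaw μ P π t s * π s a * P s a s'

namespace SICMDP

variable {S A : Type*} [Fintype S] [Fintype A] {dim : ℕ}

/-- Expected discounted sum `V_f^π(μ) = 𝔼 ∑ₜ γ^t f(s_t, a_t)` of `f` under the policy `π`, in the
SICMDP that has the transition probabilities `P'` and agrees with `M` otherwise. -/
noncomputable def value (M : SICMDP S A dim) (P' : S → A → S → ℝ) (π : S → A → ℝ)
    (f : S → A → ℝ) : ℝ :=
  ∑' t : ℕ, M.γ ^ t * ∑ s, ∑ a, stateLaw M.μ P' π t s * π s a * f s a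

/-- `π` is a policy that satisfies all constraints when the transition probabilities are `P'`. -/
def IsFeasible (M : SICMDP S A dim) (P' : S → A → S → ℝ) (π : S → A → ℝ) : Prop :=
  IsPolicy π ∧ ∀ y ∈ M.Y, M.value P' π (M.c y) ≤ M.u y

/-- `π` is an optimal policy of the (true) SICMDP `M`. -/
def IsOptimalPolicy (M : SICMDP S A dim) (π : S → A → ℝ) : Prop :=
  M.IsFeasible M.P π ∧
    ∀ π', M.IsFeasible M.P π' → M.value M.P π' M.r ≤ M.value M.P π M.r

end SICMDP

section Empirical

variable {S A ι : Type*} [Fintype S] [Fintype ι]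

open Classical in
/-- `n(s, a, s')`: how often the transition occurs in the dataset `D`. -/
noncomputable def transCount (D : ι → S × A × S) (s : S) (a : A) (s' : S) : ℕ :=
  (Finset.univ.filter fun i => D i = (s, a, s')).card

/-- `n(s, a) = ∑_{s'} n(s, a, s')`. -/
noncomputable def visitCount (D : ι → S × A × S) (s : S) (a : A) : ℕ :=
  ∑ s', transCount D s a s'

/-- The empirical transition probabilities. -/
noncomputable def empKernel (D : ι → S × A × S) (s : S) (a : A) (s' : S) : ℝ :=
  (transCount D s a s' : ℝ) / max 1 (visitCount D s a : ℝ)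

/-- The confidence radius `d_δ(s, a, s')` (meaningful if `n(s, a, s') > 0`). -/
noncomputable def confRadius (D : ι → S × A × S) (δ : ℝ) (s : S) (a : A) (s' : S) : ℝ :=
  min
    (Real.sqrt (2 * empKernel D s a s' * (1 - empKernel D s a s') * Real.log (4 / δ) /
        transCount D s a s') + 4 * Real.log (4 / δ) / transCount D s a s')
    (Real.sqrt (Real.log (2 / δ) / (2 * transCount D s a s')))

/-- The transition probabilities of the SICMDPs in the optimistic set `M_δ`, where `succ s a` is
the set of the next states that are known to be the only possible ones. The radius is infinite
when `n(s, a, s') = 0`. -/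
def confSet (D : ι → S × A × S) (succ : S → A → Set S) (δ : ℝ) : Set (S → A → S → ℝ) :=
  {P' | ∀ s a, P' s a ∈ stdSimplex ℝ S ∧ (∀ s', s' ∉ succ s a → P' s a s' = 0) ∧
    ∀ s', 0 < transCount D s a s' → |P' s a s' - empKernel D s a s'| ≤ confRadius D δ s a s'}

end Empirical

namespace SICMDP

variable {S A ι : Type*} [Fintype S] [Fintype A] [Fintype ι] {dim : ℕ}

/-- `(P', π)` is feasible for the optimistic planning problem. -/
def OptimisticFeasible (M : SICMDP S A dim) (D : ι → S × A × S) (succ : S → A → Set S) (δ : ℝ)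
    (P' : S → A → S → ℝ) (π : S → A → ℝ) : Prop :=
  P' ∈ confSet D succ δ ∧ M.IsFeasible P' π

/-- `(P', π)` is an exact solution of the optimistic planning problem. The transition
probabilities `M.P` play no role here. -/
def OptimisticSolution (M : SICMDP S A dim) (D : ι → S × A × S) (succ : S → A → Set S) (δ : ℝ)
    (P' : S → A → S → ℝ) (π : S → A → ℝ) : Prop :=
  M.OptimisticFeasible D succ δ P' π ∧
    ∀ P'' π'', M.OptimisticFeasible D succ δ P'' π'' → M.value P'' π'' M.r ≤ M.value P' π M.r

end SICMDP

section Tree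

variable {S : Type*} [Fintype S]

/-- Depth of the binary trees whose leaves are the states. -/
def treeDepth (S : Type*) [Fintype S] : ℕ := max 1 (Nat.clog 2 (Fintype.card S))

/-- The states are numbered by `e`. The vertices of depth `k` of the binary tree correspond to the
blocks of consecutive states on which the number divided by `2 ^ (depth - k)` is constant. -/
def blockIndex (e : S ≃ Fin (Fintype.card S)) (k : ℕ) (s' : S) : ℕ :=
  (e s' : ℕ) / 2 ^ (treeDepth S - k)

/-- Vertices of the binary tree that are neither the root nor a leaf: pairs of a depth strictly
between `0` and `treeDepth S`, and the number of a nonempty block of that depth. -/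
def InnerNode (e : S ≃ Fin (Fintype.card S)) : Type :=
  {q : Fin (treeDepth S) × Fin (Fintype.card S) //
    0 < (q.1 : ℕ) ∧ ∃ s', blockIndex e q.1 s' = q.2}

noncomputable instance (e : S ≃ Fin (Fintype.card S)) : Fintype (InnerNode e) :=
  haveI : Finite (InnerNode e) := by unfold InnerNode; infer_instance
  Fintype.ofFinite _

/-- States of the transformed SICMDP: the original states, and for each pair `(s, a)` a copy of
the inner vertices of the binary tree. -/
abbrev TreeState (A : Type*) (e : S ≃ Fin (Fintype.card S)) : Type _ :=
  S ⊕ (S × A × InnerNode e)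

variable {A : Type*} (e : S ≃ Fin (Fintype.card S))

/-- The vertex of depth `k` on the path that leads from `s`, through the tree of `(s, a)`,
to the leaf `s'`. -/
def treePath (s : S) (a : A) (s' : S) (k : ℕ) : TreeState A e :=
  if h : 0 < k ∧ k < treeDepth S then
    Sum.inr (s, a, ⟨(⟨k, h.2⟩, ⟨blockIndex e k s', (Nat.div_le_self _ _).trans_lt (e s').2⟩),
      h.1, s', rfl⟩)
  else if k = 0 then Sum.inl s else Sum.inl s'

/-- The pair `(s, a)` in whose tree one is when playing `b` in the state `x`. -/
def treeOrigin (x : TreeState A e) (b : A) : S × A :=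
  match x with
  | Sum.inl s => (s, b)
  | Sum.inr (s, a, _) => (s, a)

/-- The depth of the state `x` in that tree. -/
def treeLevel (x : TreeState A e) : ℕ :=
  match x with
  | Sum.inl _ => 0
  | Sum.inr (_, _, q) => (q.1.1 : ℕ)

/-- The leaf `s'` lies below `x` (when `b` is played in `x`). -/
def IsBelow (x : TreeState A e) (b : A) (s' : S) : Prop :=
  treePath e (treeOrigin e x b).1 (treeOrigin e x b).2 s' (treeLevel e x) = x

/-- The state that follows `x` on the way to the leaf `s'`. -/
def treeNext (x : TreeState A e) (b : A) (s' : S) : TreeState A e :=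
  treePath e (treeOrigin e x b).1 (treeOrigin e x b).2 s' (treeLevel e x + 1)

/-- The (at most two) states that can follow `x`: its children in the tree. -/
def treeSucc (x : TreeState A e) (b : A) : Set (TreeState A e) :=
  {x' | ∃ s', IsBelow e x b s' ∧ treeNext e x b s' = x'}

open Classical in
/-- Weight of the leaf `s'` below `x`: its probability under `P`, or `1` if all leaves below `x`
have probability zero. Leaves that are not below `x` have weight zero. -/
noncomputable def leafWeight (P : S → A → S → ℝ) (x : TreeState A e) (b : A) (s' : S) : ℝ :=
  if IsBelow e x b s' then
    if ∃ s'', IsBelow e x b s'' ∧ P (treeOrigin e x b).1 (treeOrigin e x b).2 s'' ≠ 0 then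
      P (treeOrigin e x b).1 (treeOrigin e x b).2 s'
    else 1
  else 0

open Classical in
/-- Transition probabilities of the transformed SICMDP: the next vertex on the way to a leaf
`s'` drawn from `P(· | s, a)`, conditioned on `s'` being below `x`. -/
noncomputable def treeKernel (P : S → A → S → ℝ) (x : TreeState A e) (b : A)
    (x' : TreeState A e) : ℝ :=
  (∑ s', if treeNext e x b s' = x' then leafWeight e P x b s' else 0) /
    ∑ s', leafWeight e P x b s'

theorem exists_isBelow [Nonempty S] (x : TreeState A e) (b : A) : ∃ s', IsBelow e x b s' := by
  rcases x with s | ⟨s, a, ⟨⟨k, j⟩, hk, s', hs'⟩⟩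
  · exact ⟨s, by simp [IsBelow, treePath, treeLevel]; rfl⟩
  · refine ⟨s', ?_⟩
    have hk' : 0 < (k : ℕ) := hk
    have hs'' : blockIndex e k s' = j := hs'
    simp [IsBelow, treePath, treeLevel, treeOrigin, hk', hs'']

theorem leafWeight_nonneg {P : S → A → S → ℝ} [Fintype A]
    (hP : ∀ s a, P s a ∈ stdSimplex ℝ S) (x : TreeState A e) (b : A) (s' : S) :
    0 ≤ leafWeight e P x b s' := by
  unfold leafWeight
  split_ifs
  · exact (hP _ _).1 _
  · exact zero_le_one
  · exact le_rfl

theorem sum_leafWeight_pos {P : S → A → S → ℝ} [Fintype A]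
    (hP : ∀ s a, P s a ∈ stdSimplex ℝ S) (x : TreeState A e) (b : A) :
    0 < ∑ s', leafWeight e P x b s' := by
  have hne : Nonempty S := by
    rcases x with s | ⟨s, _⟩ <;> exact ⟨s⟩
  refine Finset.sum_pos' (fun s' _ => leafWeight_nonneg e hP x b s') ?_
  by_cases h : ∃ s'', IsBelow e x b s'' ∧
      P (treeOrigin e x b).1 (treeOrigin e x b).2 s'' ≠ 0
  · obtain ⟨s'', h1, h2⟩ := h
    refine ⟨s'', Finset.mem_univ _, ?_⟩
    rw [leafWeight, if_pos h1, if_pos ⟨s'', h1, h2⟩]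
    exact lt_of_le_of_ne ((hP _ _).1 _) (Ne.symm h2)
  · obtain ⟨s', h1⟩ := exists_isBelow e x b
    refine ⟨s', Finset.mem_univ _, ?_⟩
    rw [leafWeight, if_pos h1, if_neg h]
    exact zero_lt_one

theorem treeKernel_mem {P : S → A → S → ℝ} [Fintype A]
    (hP : ∀ s a, P s a ∈ stdSimplex ℝ S) (x : TreeState A e) (b : A) :
    treeKernel e P x b ∈ stdSimplex ℝ (TreeState A e) := by
  have hpos := sum_leafWeight_pos e hP x b
  refine ⟨fun x' => div_nonneg (Finset.sum_nonneg fun s' _ => ?_) hpos.le, ?_⟩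
  · split_ifs
    · exact leafWeight_nonneg e hP x b s'
    · exact le_rfl
  · unfold treeKernel
    rw [← Finset.sum_div, Finset.sum_comm, div_eq_one_iff_eq hpos.ne']
    refine Finset.sum_congr rfl fun s' _ => ?_
    simp

/-- A sample `(s, a, s')` of the original SICMDP is turned into the transitions along the path
from `s` to `s'` in the tree of `(s, a)`. In the added states the action has no effect, and the
transition is recorded for every action. -/
def treeDataset {ι : Type*} (D : ι → S × A × S) :
    ι × Option (Fin (treeDepth S - 1) × A) → TreeState A e × A × TreeState A e
  | (i, none) => (treePath e (D i).1 (D i).2.1 (D i).2.2 0, (D i).2.1,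
      treePath e (D i).1 (D i).2.1 (D i).2.2 1)
  | (i, some (k, b)) => (treePath e (D i).1 (D i).2.1 (D i).2.2 (k + 1), b,
      treePath e (D i).1 (D i).2.1 (D i).2.2 (k + 2))

end Tree

namespace SICMDP

variable {S A : Type*} [Fintype S] [Fintype A] {dim : ℕ}

/-- The transformed SICMDP, in which every state-action pair has at most two possible next states.
One step of `M` becomes `treeDepth S` steps; rewards, costs and initial probabilities of the added
states are zero, and the discount factor is the corresponding root of that of `M`. -/
noncomputable def tree (M : SICMDP S A dim) (e : S ≃ Fin (Fintype.card S)) :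
    SICMDP (TreeState A e) A dim where
  Y := M.Y
  isCompact_Y := M.isCompact_Y
  P := treeKernel e M.P
  P_mem := treeKernel_mem e M.P_mem
  r := Sum.elim M.r (fun _ _ => 0)
  r_mem := by
    rintro (s | x) a
    · exact M.r_mem s a
    · simp
  c := fun y => Sum.elim (M.c y) (fun _ _ => 0)
  c_mem := by
    rintro y hy (s | x) a
    · exact M.c_mem y hy s a
    · simp
  u := M.u
  μ := Sum.elim M.μ (fun _ => 0)
  μ_mem := by
    refine ⟨?_, ?_⟩
    · rintro (s | x)
      · exact M.μ_mem.1 s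
      · simp
    · simpa using M.μ_mem.2
  γ := M.γ ^ (1 / (treeDepth S : ℝ))
  γ_nonneg := Real.rpow_nonneg M.γ_nonneg _
  γ_lt_one := by
    refine Real.rpow_lt_one M.γ_nonneg M.γ_lt_one ?_
    have : 0 < treeDepth S := lt_of_lt_of_le Nat.one_pos (le_max_left _ _)
    positivity

/-- `alg` (a map from datasets of size `m` to policies of `M`) is the modified SI-CRL algorithm
with confidence parameter `δ`: it runs SI-CRL on the transformed SICMDP, solves the optimistic
problem exactly (whenever that has a feasible point), and returns the resulting policy on the
original states. -/
def IsModifiedSICRL (M : SICMDP S A dim) (e : S ≃ Fin (Fintype.card S)) (δ : ℝ) {m : ℕ}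
    (alg : (Fin m → S × A × S) → S → A → ℝ) : Prop :=
  ∀ D, IsPolicy (alg D) ∧
    ((∃ P' π, (M.tree e).OptimisticFeasible (treeDataset e D) (treeSucc e) δ P' π) →
      ∃ P' π, (M.tree e).OptimisticSolution (treeDataset e D) (treeSucc e) δ P' π ∧
        ∀ s, alg D s = π (Sum.inl s))

open Classical in
/-- Probability of the event `E` for a dataset of `m` independent samples `(s_i, a_i, s_i')`, with
`(s_i, a_i)` drawn from `ν` and `s_i'` drawn from `P(· | s_i, a_i)`. -/
noncomputable def datasetProb (M : SICMDP S A dim) (ν : S × A → ℝ) (m : ℕ)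
    (E : Set (Fin m → S × A × S)) : ℝ :=
  ∑ D : Fin m → S × A × S,
    if D ∈ E then ∏ i, ν ((D i).1, (D i).2.1) * M.P (D i).1 (D i).2.1 (D i).2.2 else 0

/-- The algorithm `alg` is `(ε, δ)`-optimal on datasets of `m` samples generated by `ν` (where
`πopt` is an optimal policy of `M`). -/
def IsPACOptimal (M : SICMDP S A dim) (πopt : S → A → ℝ) (ν : S × A → ℝ) (ε δ : ℝ) {m : ℕ}
    (alg : (Fin m → S × A × S) → S → A → ℝ) : Prop :=
  1 - δ ≤ M.datasetProb ν m
    {D | M.value M.P πopt M.r - M.value M.P (alg D) M.r ≤ ε ∧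
      ∀ y ∈ M.Y, M.value M.P (alg D) (M.c y) - M.u y ≤ ε}

end SICMDP

/-- The smallest positive value of `ν`. -/
noncomputable def minProb {α : Type*} (ν : α → ℝ) : ℝ := sInf {p | 0 < p ∧ ∃ x, ν x = p}

/-!
The difference between the values of a policy under the true and under an optimistic transition
kernel is the sum of the one-step errors `(P' - P) V'` at the value function `V'` of the
*optimistic* kernel, weighted by the occupation measure of the *true* kernel
(`SICMDP.abs_value_sub_value_le`). In the transformed process at most two next states are possible,
so `|(P' - P) V'|` equals `|p' - p|` times the difference of two values. Since `|p' - p|` is of order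
`√(p (1 - p) L / n)` with `L = log (4 / δ)`, this product is of order `√(Var(V') L / n)`, whatever
`V'` is (`abs_sum_sub_mul_le`). Hence nothing is lost by the dependence of `V'` on the data. The
radius involves the number of occurrences of a transition instead of the number `n` of visits, which
is harmless because one of the two next states accounts for at least half of the visits, and the
deviations at both next states are equal (`one_step_error`).

By the Cauchy–Schwarz inequality the accumulated error `E` is at most of order
`√(Θ · ∑ w Var(V'))` with `Θ = ∑ w L / n`. Two facts bound the factors.

* `sum_vecVar_le`: `∑ w Var(V') ≤ 2 H² + 2 H E` with the horizon `H = 1 / (1 - γ)` of the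
  transformed process. The value function and the occupation measure belong to different kernels,
  and the price for this is the term with `E`, which can be absorbed (`le_of_self_bounding`). This
  yields `E` of order `H √Θ`, so that the horizon enters the sample size with the third power.
* `sum_occupancy_div_le`: a vertex of the tree of `(s, a)` is visited, both in the dataset and by the
  policy, in proportion to the probability of the leaves below it. So `w / n` is at most of order
  `w(s, a) / (m ν(s, a))` at each of the fewer than `2 |S|` vertices, and `Θ` is at most of order
  `|S| L H / (m ν_min)`. Vertices with too few expected visits contribute no more than that, up to
  the factor `H`.

The confidence event is treated by Chernoff's method conditionally on which samples run through a
given vertex (`iidProb_chernoff_le`), with the bounds of Hoeffding and Bernstein, and by a union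
bound over all vertices (`SICMDP.one_sub_le_datasetProb`). On that event the true kernel belongs to
the optimistic set, and the comparison of values turns optimism into near-optimality
(`SICMDP.IsModifiedSICRL.good`). Values in the original and the transformed process agree because
the flow equation of the latter restricts to that of the former (`isFlow_restrict`, `value_tree`).
-/

/-! ### Discounted Markov decision processes on a finite state space -/

section Discounted

variable {X A : Type*} [Fintype X] [Fintype A]

/-- Averaging a function bounded by `h` against a probability vector. -/
theorem stdSimplex_avg_mem_Icc {ι : Type*} [Fintype ι] {p V : ι → ℝ} {h : ℝ}
    (hp : p ∈ stdSimplex ℝ ι) (hV : ∀ x, V x ∈ Set.Icc 0 h) :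
    ∑ x, p x * V x ∈ Set.Icc 0 h := by
  refine ⟨Finset.sum_nonneg fun x _ => mul_nonneg (hp.1 x) (hV x).1, ?_⟩
  calc ∑ x, p x * V x ≤ ∑ x, p x * h :=
        Finset.sum_le_sum fun x _ => mul_le_mul_of_nonneg_left (hV x).2 (hp.1 x)
    _ = h := by rw [← Finset.sum_mul, hp.2, one_mul]

/-- The Bellman equation of a stationary policy with a `[0, 1]`-valued reward has a solution with
values in `[0, 1 / (1 - g)]`. It is obtained as the limit of value iteration started at `0`. -/
theorem exists_bellman {g : ℝ} (hg0 : 0 ≤ g) (hg1 : g < 1) {K : X → A → X → ℝ}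
    (hK : ∀ x b, K x b ∈ stdSimplex ℝ X) {π : X → A → ℝ} (hπ : IsPolicy π)
    {f : X → A → ℝ} (hf : ∀ x b, f x b ∈ Set.Icc (0 : ℝ) 1) :
    ∃ V : X → ℝ, (∀ x, V x ∈ Set.Icc 0 (1 / (1 - g))) ∧
      ∀ x, V x = ∑ b, π x b * (f x b + g * ∑ x', K x b x' * V x') := by
  have h1g : 0 < 1 - g := by linarith
  let F : (X → ℝ) → X → ℝ := fun V x => ∑ b, π x b * (f x b + g * ∑ x', K x b x' * V x')
  let v : ℕ → X → ℝ := fun n => F^[n] 0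
  have hv : ∀ n, v (n + 1) = F (v n) := fun n => Function.iterate_succ_apply' F n 0
  have hF : Monotone F := by
    intro V W hVW x
    refine Finset.sum_le_sum fun b _ => mul_le_mul_of_nonneg_left ?_ ((hπ x).1 b)
    have : ∑ x', K x b x' * V x' ≤ ∑ x', K x b x' * W x' :=
      Finset.sum_le_sum fun x' _ => mul_le_mul_of_nonneg_left (hVW x') ((hK x b).1 x')
    nlinarith
  have hb : ∀ n x, v n x ∈ Set.Icc 0 (1 / (1 - g)) := by
    intro n
    induction n with
    | zero => intro x; exact ⟨le_rfl, by positivity⟩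
    | succ n ih =>
      intro x
      rw [hv]
      refine stdSimplex_avg_mem_Icc (hπ x) fun b => ?_
      have h1 := stdSimplex_avg_mem_Icc (hK x b) ih
      refine ⟨add_nonneg (hf x b).1 (mul_nonneg hg0 h1.1), ?_⟩
      have h2 : g * ∑ x', K x b x' * v n x' ≤ g * (1 / (1 - g)) :=
        mul_le_mul_of_nonneg_left h1.2 hg0
      have h3 : 1 + g * (1 / (1 - g)) = 1 / (1 - g) := by field_simp; ring
      linarith [(hf x b).2]
  have hmono : Monotone v := by
    refine monotone_nat_of_le_succ fun n => ?_
    induction n with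
    | zero => intro x; exact (hb 1 x).1
    | succ n ih => rw [hv, hv (n + 1)]; exact hF ih
  have hlim : ∀ x, Filter.Tendsto (fun n => v n x) Filter.atTop (nhds (⨆ n, v n x)) := fun x =>
    tendsto_atTop_ciSup (fun i j hij => hmono hij x)
      ⟨1 / (1 - g), by rintro _ ⟨n, rfl⟩; exact (hb n x).2⟩
  refine ⟨fun x => ⨆ n, v n x, fun x => ?_, fun x => ?_⟩
  · exact isClosed_Icc.mem_of_tendsto (hlim x) (Filter.Eventually.of_forall fun n => hb n x)
  · have h1 := (hlim x).comp (Filter.tendsto_add_atTop_nat 1)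
    have h2 : Filter.Tendsto (fun n => F (v n) x) Filter.atTop
        (nhds (F (fun x => ⨆ n, v n x) x)) :=
      tendsto_finsetSum _ fun b _ => (tendsto_const_nhds.add
        ((tendsto_finsetSum _ fun x' _ => (hlim x').const_mul _).const_mul g)).const_mul _
    refine tendsto_nhds_unique h1 (h2.congr fun n => ?_)
    simp [hv]

/-- `w` solves the flow equation of a discounted occupation measure: the initial distribution
`μ` and the discounted inflow under the kernel `K` and the policy `π` balance `w`. -/
def IsFlow (g : ℝ) (μ : X → ℝ) (K : X → A → X → ℝ) (π : X → A → ℝ) (w : X → ℝ) : Prop :=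
  ∀ x', w x' = μ x' + g * ∑ x, ∑ b, w x * π x b * K x b x'

theorem IsFlow.sum_mul {g : ℝ} {μ : X → ℝ} {K : X → A → X → ℝ} {π : X → A → ℝ} {w : X → ℝ}
    (h : IsFlow g μ K π w) (F : X → ℝ) :
    ∑ x, w x * F x = ∑ x, μ x * F x + g * ∑ x, ∑ b, w x * π x b * ∑ x', K x b x' * F x' := by
  calc ∑ x', w x' * F x'
      = ∑ x', (μ x' * F x' + g * ∑ x, ∑ b, w x * π x b * (K x b x' * F x')) := by
        refine Finset.sum_congr rfl fun x' _ => ?_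
        rw [h x', add_mul, mul_assoc, Finset.sum_mul]
        simp_rw [Finset.sum_mul, mul_assoc]
    _ = _ := by
        rw [Finset.sum_add_distrib, ← Finset.mul_sum, Finset.sum_comm]
        congr 2
        refine Finset.sum_congr rfl fun x _ => ?_
        rw [Finset.sum_comm]
        simp_rw [Finset.mul_sum]

theorem IsFlow.sum_eq {g : ℝ} (hg1 : g < 1) {μ : X → ℝ} (hμ : μ ∈ stdSimplex ℝ X)
    {K : X → A → X → ℝ} (hK : ∀ x b, K x b ∈ stdSimplex ℝ X) {π : X → A → ℝ} (hπ : IsPolicy π)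
    {w : X → ℝ} (h : IsFlow g μ K π w) : ∑ x, w x = 1 / (1 - g) := by
  have h1 := h.sum_mul (fun _ => 1)
  simp only [mul_one, (hK _ _).2, ← Finset.mul_sum, (hπ _).2, hμ.2] at h1
  rw [eq_div_iff (by linarith)]
  linarith

variable {μ : X → ℝ} {K : X → A → X → ℝ} {π : X → A → ℝ}

theorem stateLaw_mem (hμ : μ ∈ stdSimplex ℝ X) (hK : ∀ x b, K x b ∈ stdSimplex ℝ X)
    (hπ : IsPolicy π) (t : ℕ) : stateLaw μ K π t ∈ stdSimplex ℝ X := by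
  induction t with
  | zero => exact hμ
  | succ t ih =>
    refine ⟨fun x' => Finset.sum_nonneg fun x _ => Finset.sum_nonneg fun b _ =>
      mul_nonneg (mul_nonneg (ih.1 x) ((hπ x).1 b)) ((hK x b).1 x'), ?_⟩
    change ∑ x', ∑ x, ∑ b, stateLaw μ K π t x * π x b * K x b x' = 1
    rw [Finset.sum_comm, ← ih.2]
    refine Finset.sum_congr rfl fun x _ => ?_
    rw [Finset.sum_comm]
    simp_rw [← Finset.mul_sum, (hK _ _).2, mul_one, ← Finset.mul_sum, (hπ _).2, mul_one]

/-- The discounted occupation measure of a policy exists. -/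
theorem exists_isFlow {g : ℝ} (hg0 : 0 ≤ g) (hg1 : g < 1) (hμ : μ ∈ stdSimplex ℝ X)
    (hK : ∀ x b, K x b ∈ stdSimplex ℝ X) (hπ : IsPolicy π) :
    ∃ w : X → ℝ, (∀ x, 0 ≤ w x) ∧ IsFlow g μ K π w := by
  have hlaw := stateLaw_mem hμ hK hπ
  have hsum : ∀ x, Summable fun t => g ^ t * stateLaw μ K π t x := by
    intro x
    refine Summable.of_nonneg_of_le (fun t => mul_nonneg (pow_nonneg hg0 t) ((hlaw t).1 x))
      (fun t => ?_) (summable_geometric_of_lt_one hg0 hg1)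
    have h1 : stateLaw μ K π t x ≤ 1 := by
      rw [← (hlaw t).2]
      exact Finset.single_le_sum (fun y _ => (hlaw t).1 y) (Finset.mem_univ x)
    exact mul_le_of_le_one_right (pow_nonneg hg0 t) h1
  refine ⟨fun x => ∑' t, g ^ t * stateLaw μ K π t x, fun x => tsum_nonneg fun t =>
    mul_nonneg (pow_nonneg hg0 t) ((hlaw t).1 x), fun x' => ?_⟩
  change ∑' t, g ^ t * stateLaw μ K π t x' = _
  rw [(hsum x').tsum_eq_zero_add]
  congr 1
  · simp [stateLaw]
  · have h1 : HasSum (fun t => g * ∑ x, ∑ b, g ^ t * stateLaw μ K π t x * π x b * K x b x')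
        (g * ∑ x, ∑ b, (∑' t, g ^ t * stateLaw μ K π t x) * π x b * K x b x') :=
      (hasSum_sum fun x _ => hasSum_sum fun b _ =>
        (((hsum x).hasSum.mul_right _).mul_right _)).mul_left g
    rw [← h1.tsum_eq]
    refine tsum_congr fun t => ?_
    simp only [stateLaw, Finset.mul_sum]
    refine Finset.sum_congr rfl fun x _ => Finset.sum_congr rfl fun b _ => ?_
    ring

namespace SICMDP

variable {dim : ℕ}

/-- The value of a policy is the initial average of any solution of the Bellman equation. -/
theorem value_eq_of_bellman (M : SICMDP X A dim) (hK : ∀ x b, K x b ∈ stdSimplex ℝ X)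
    (hπ : IsPolicy π) {f : X → A → ℝ} (hf : ∀ x b, 0 ≤ f x b) {V : X → ℝ} {h : ℝ}
    (hVb : ∀ x, V x ∈ Set.Icc 0 h)
    (hV : ∀ x, V x = ∑ b, π x b * (f x b + M.γ * ∑ x', K x b x' * V x')) :
    M.value K π f = ∑ x, M.μ x * V x := by
  have hlaw := stateLaw_mem M.μ_mem hK hπ
  set a : ℕ → ℝ := fun t => M.γ ^ t * ∑ x, stateLaw M.μ K π t x * V x with ha
  have hstep : ∀ t, M.γ ^ t * ∑ x, ∑ b, stateLaw M.μ K π t x * π x b * f x b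
      = a t - a (t + 1) := by
    intro t
    have h1 : ∑ x, stateLaw M.μ K π t x * V x
        = ∑ x, ∑ b, stateLaw M.μ K π t x * π x b * f x b
          + M.γ * ∑ x', stateLaw M.μ K π (t + 1) x' * V x' := by
      have h2 : ∑ x', stateLaw M.μ K π (t + 1) x' * V x'
          = ∑ x, ∑ b, stateLaw M.μ K π t x * π x b * ∑ x', K x b x' * V x' := by
        simp only [stateLaw, Finset.sum_mul]
        rw [Finset.sum_comm]
        refine Finset.sum_congr rfl fun x _ => ?_
        rw [Finset.sum_comm]
        simp_rw [Finset.mul_sum, mul_assoc]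
      rw [h2, Finset.mul_sum, ← Finset.sum_add_distrib]
      refine Finset.sum_congr rfl fun x _ => ?_
      rw [hV x, Finset.mul_sum, Finset.mul_sum, ← Finset.sum_add_distrib]
      refine Finset.sum_congr rfl fun b _ => ?_
      ring
    simp only [ha]
    rw [h1]
    ring
  have hlim : Filter.Tendsto a Filter.atTop (nhds 0) := by
    have h3 : Filter.Tendsto (fun t => M.γ ^ t * h) Filter.atTop (nhds 0) := by
      simpa using (tendsto_pow_atTop_nhds_zero_of_lt_one M.γ_nonneg M.γ_lt_one).mul_const h
    refine squeeze_zero (fun t => ?_) (fun t => ?_) h3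
    · exact mul_nonneg (pow_nonneg M.γ_nonneg t) (stdSimplex_avg_mem_Icc (hlaw t) hVb).1
    · exact mul_le_mul_of_nonneg_left (stdSimplex_avg_mem_Icc (hlaw t) hVb).2
        (pow_nonneg M.γ_nonneg t)
  refine HasSum.tsum_eq ((hasSum_iff_tendsto_nat_of_nonneg (fun t => mul_nonneg
    (pow_nonneg M.γ_nonneg t) (Finset.sum_nonneg fun x _ => Finset.sum_nonneg fun b _ =>
      mul_nonneg (mul_nonneg ((hlaw t).1 x) ((hπ x).1 b)) (hf x b))) _).2 ?_)
  simp_rw [hstep, Finset.sum_range_sub']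
  simpa [ha, stateLaw] using hlim.const_sub (a 0)

/-- The value of a policy is the integral of the reward against any solution of the flow
equation. -/
theorem value_eq_of_isFlow (M : SICMDP X A dim) (hK : ∀ x b, K x b ∈ stdSimplex ℝ X)
    (hπ : IsPolicy π) {f : X → A → ℝ} (hf : ∀ x b, f x b ∈ Set.Icc (0 : ℝ) 1) {w : X → ℝ}
    (hw : IsFlow M.γ M.μ K π w) : M.value K π f = ∑ x, ∑ b, w x * π x b * f x b := by
  obtain ⟨V, hVb, hV⟩ := exists_bellman M.γ_nonneg M.γ_lt_one hK hπ hf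
  rw [M.value_eq_of_bellman hK hπ (fun x b => (hf x b).1) hVb hV]
  have h1 := hw.sum_mul V
  have h2 : ∑ x, w x * V x = ∑ x, ∑ b, w x * π x b * f x b
      + M.γ * ∑ x, ∑ b, w x * π x b * ∑ x', K x b x' * V x' := by
    rw [Finset.mul_sum, ← Finset.sum_add_distrib]
    refine Finset.sum_congr rfl fun x _ => ?_
    conv_lhs => rw [hV x]
    rw [Finset.mul_sum, Finset.mul_sum, ← Finset.sum_add_distrib]
    refine Finset.sum_congr rfl fun b _ => ?_
    ring
  linarith

/-- Simulation lemma: the error caused by replacing the kernel `K` by `K'` is bounded by the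
average one-step error at the value function of `K'`, under the occupation measure of `K`. -/
theorem abs_value_sub_value_le (M : SICMDP X A dim) {K' : X → A → X → ℝ}
    (hK : ∀ x b, K x b ∈ stdSimplex ℝ X) (hK' : ∀ x b, K' x b ∈ stdSimplex ℝ X)
    (hπ : IsPolicy π) {f : X → A → ℝ} (hf : ∀ x b, f x b ∈ Set.Icc (0 : ℝ) 1) {w V : X → ℝ}
    (hw0 : ∀ x, 0 ≤ w x) (hw : IsFlow M.γ M.μ K π w) {h : ℝ} (hVb : ∀ x, V x ∈ Set.Icc 0 h)
    (hV : ∀ x, V x = ∑ b, π x b * (f x b + M.γ * ∑ x', K' x b x' * V x')) :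
    |M.value K π f - M.value K' π f| ≤
      ∑ x, ∑ b, w x * π x b * (M.γ * |∑ x', (K' x b x' - K x b x') * V x'|) := by
  rw [M.value_eq_of_isFlow hK hπ hf hw, M.value_eq_of_bellman hK' hπ (fun x b => (hf x b).1) hVb hV]
  have h1 := hw.sum_mul V
  have h2 : ∑ x, w x * V x = ∑ x, ∑ b, w x * π x b * f x b
      + M.γ * ∑ x, ∑ b, w x * π x b * ∑ x', K' x b x' * V x' := by
    rw [Finset.mul_sum, ← Finset.sum_add_distrib]
    refine Finset.sum_congr rfl fun x _ => ?_
    conv_lhs => rw [hV x]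
    rw [Finset.mul_sum, Finset.mul_sum, ← Finset.sum_add_distrib]
    refine Finset.sum_congr rfl fun b _ => ?_
    ring
  have h3 : ∑ x, ∑ b, w x * π x b * f x b - ∑ x, M.μ x * V x
      = ∑ x, ∑ b, w x * π x b * (M.γ * (-∑ x', (K' x b x' - K x b x') * V x')) := by
    have h4 : ∑ x, ∑ b, w x * π x b * (M.γ * (-∑ x', (K' x b x' - K x b x') * V x'))
        = M.γ * ∑ x, ∑ b, w x * π x b * ∑ x', K x b x' * V x'
          - M.γ * ∑ x, ∑ b, w x * π x b * ∑ x', K' x b x' * V x' := by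
      rw [← mul_sub, ← Finset.sum_sub_distrib, Finset.mul_sum]
      refine Finset.sum_congr rfl fun x _ => ?_
      rw [← Finset.sum_sub_distrib, Finset.mul_sum]
      refine Finset.sum_congr rfl fun b _ => ?_
      simp_rw [sub_mul, Finset.sum_sub_distrib]
      ring
    linarith
  rw [h3]
  refine (Finset.abs_sum_le_sum_abs _ _).trans (Finset.sum_le_sum fun x _ =>
    (Finset.abs_sum_le_sum_abs _ _).trans (Finset.sum_le_sum fun b _ => ?_))
  rw [abs_mul, abs_mul M.γ, abs_neg, abs_of_nonneg M.γ_nonneg,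
    abs_of_nonneg (mul_nonneg (hw0 x) ((hπ x).1 b))]

end SICMDP

/-- Variance of `V` under the probability vector `p`. -/
def vecVar {ι : Type*} [Fintype ι] (p V : ι → ℝ) : ℝ :=
  ∑ x, p x * V x ^ 2 - (∑ x, p x * V x) ^ 2

theorem vecVar_nonneg {ι : Type*} [Fintype ι] {p : ι → ℝ} (hp : p ∈ stdSimplex ℝ ι)
    (V : ι → ℝ) : 0 ≤ vecVar p V := by
  have h1 : vecVar p V = ∑ x, p x * (V x - ∑ y, p y * V y) ^ 2 := by
    set m := ∑ y, p y * V y with hm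
    have h2 : ∀ x, p x * (V x - m) ^ 2 = p x * V x ^ 2 - 2 * m * (p x * V x) + m ^ 2 * p x :=
      fun x => by ring
    simp_rw [h2, Finset.sum_add_distrib, Finset.sum_sub_distrib, ← Finset.mul_sum, hp.2, ← hm]
    rw [vecVar, ← hm]
    ring
  rw [h1]
  exact Finset.sum_nonneg fun x _ => mul_nonneg (hp.1 x) (sq_nonneg _)

/-- Self-bounding form of the law of total variance: under the occupation measure of `K`, the sum
of the one-step variances of a value function that belongs to *another* kernel `K'` is of order
`h ^ 2` up to the average one-step error between the two kernels. -/
theorem sum_vecVar_le {g : ℝ} (hg0 : 0 ≤ g) (hg1 : g < 1) {K' : X → A → X → ℝ}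
    (hμ : μ ∈ stdSimplex ℝ X) (hK : ∀ x b, K x b ∈ stdSimplex ℝ X)
    (hK' : ∀ x b, K' x b ∈ stdSimplex ℝ X)
    (hπ : IsPolicy π) {f : X → A → ℝ} (hf : ∀ x b, f x b ∈ Set.Icc (0 : ℝ) 1) {w V : X → ℝ}
    (hw0 : ∀ x, 0 ≤ w x) (hw : IsFlow g μ K π w) (hVb : ∀ x, V x ∈ Set.Icc 0 (1 / (1 - g)))
    (hV : ∀ x, V x = ∑ b, π x b * (f x b + g * ∑ x', K' x b x' * V x')) :
    ∑ x, ∑ b, w x * π x b * (g ^ 2 * vecVar (K x b) V) ≤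
      2 * (1 / (1 - g)) ^ 2 + 2 * (1 / (1 - g)) *
        ∑ x, ∑ b, w x * π x b * (g * |∑ x', (K' x b x' - K x b x') * V x'|) := by
  set h : ℝ := 1 / (1 - g) with hh
  have h1g : 0 < 1 - g := by linarith
  have hh0 : 0 < h := by positivity
  set Q : X → A → ℝ := fun x b => f x b + g * ∑ x', K' x b x' * V x' with hQ
  have hQb : ∀ x b, Q x b ∈ Set.Icc 0 h := by
    intro x b
    have h1 := stdSimplex_avg_mem_Icc (hK' x b) hVb
    refine ⟨add_nonneg (hf x b).1 (mul_nonneg hg0 h1.1), ?_⟩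
    have h2 : g * ∑ x', K' x b x' * V x' ≤ g * h := mul_le_mul_of_nonneg_left h1.2 hg0
    have h3 : 1 + g * h = h := by rw [hh]; field_simp; ring
    simp only [hQ]
    linarith [(hf x b).2]
  have hjensen : ∀ x, V x ^ 2 ≤ ∑ b, π x b * Q x b ^ 2 := by
    intro x
    rw [hV x]
    exact sub_nonneg.1 (vecVar_nonneg (hπ x) (Q x))
  have hflow := hw.sum_mul (fun x => V x ^ 2)
  have hμV : 0 ≤ ∑ x, μ x * V x ^ 2 :=
    Finset.sum_nonneg fun x _ => mul_nonneg (hμ.1 x) (sq_nonneg _)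
  have hsq : ∑ x, w x * V x ^ 2 ≤ ∑ x, ∑ b, w x * π x b * Q x b ^ 2 := by
    refine Finset.sum_le_sum fun x _ => ?_
    simp_rw [mul_assoc, ← Finset.mul_sum]
    exact mul_le_mul_of_nonneg_left (hjensen x) (hw0 x)
  have hsplit : ∑ x, ∑ b, w x * π x b * (g ^ 2 * vecVar (K x b) V)
      = g * (g * ∑ x, ∑ b, w x * π x b * ∑ x', K x b x' * V x' ^ 2)
        - ∑ x, ∑ b, w x * π x b * (g * ∑ x', K x b x' * V x') ^ 2 := by
    rw [← mul_assoc, Finset.mul_sum, ← Finset.sum_sub_distrib]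
    refine Finset.sum_congr rfl fun x _ => ?_
    rw [Finset.mul_sum, ← Finset.sum_sub_distrib]
    refine Finset.sum_congr rfl fun b _ => ?_
    rw [vecVar]
    ring
  have hpt : ∀ x b, g * Q x b ^ 2 - (g * ∑ x', K x b x' * V x') ^ 2
      ≤ 2 * h + 2 * h * (g * |∑ x', (K' x b x' - K x b x') * V x'|) := by
    intro x b
    set e := g * ∑ x', (K' x b x' - K x b x') * V x' with he
    have h1 : g * ∑ x', K x b x' * V x' = Q x b - f x b - e := by
      simp only [hQ, he, sub_mul, Finset.sum_sub_distrib]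
      ring
    have h2 : e ≤ g * |∑ x', (K' x b x' - K x b x') * V x'| :=
      mul_le_mul_of_nonneg_left (le_abs_self _) hg0
    have h2' : 0 ≤ g * |∑ x', (K' x b x' - K x b x') * V x'| := by positivity
    rw [h1]
    obtain ⟨hq0, hq1⟩ := hQb x b
    obtain ⟨hf0, hf1⟩ := hf x b
    have h3 : Q x b * f x b ≤ h := by nlinarith
    have h4 : Q x b * e ≤ h * (g * |∑ x', (K' x b x' - K x b x') * V x'|) := by
      calc Q x b * e ≤ Q x b * (g * |∑ x', (K' x b x' - K x b x') * V x'|) :=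
            mul_le_mul_of_nonneg_left h2 hq0
        _ ≤ _ := mul_le_mul_of_nonneg_right hq1 h2'
    nlinarith [sq_nonneg (f x b + e), sq_nonneg (Q x b), mul_nonneg h1g.le (sq_nonneg (Q x b))]
  have hsum : ∑ x, ∑ b, w x * π x b = h := by
    simp_rw [← Finset.mul_sum, (hπ _).2, mul_one]
    exact hw.sum_eq hg1 hμ hK hπ
  calc ∑ x, ∑ b, w x * π x b * (g ^ 2 * vecVar (K x b) V)
      ≤ ∑ x, ∑ b, w x * π x b * (g * Q x b ^ 2 - (g * ∑ x', K x b x' * V x') ^ 2) := by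
        simp_rw [mul_sub, Finset.sum_sub_distrib]
        rw [hsplit]
        refine sub_le_sub_right ?_ _
        have h5 : ∑ x, ∑ b, w x * π x b * (g * Q x b ^ 2)
            = g * ∑ x, ∑ b, w x * π x b * Q x b ^ 2 := by
          simp_rw [Finset.mul_sum]
          refine Finset.sum_congr rfl fun x _ => Finset.sum_congr rfl fun b _ => ?_
          ring
        rw [h5]
        exact mul_le_mul_of_nonneg_left (by linarith) hg0
    _ ≤ ∑ x, ∑ b, w x * π x b *
          (2 * h + 2 * h * (g * |∑ x', (K' x b x' - K x b x') * V x'|)) :=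
        Finset.sum_le_sum fun x _ => Finset.sum_le_sum fun b _ =>
          mul_le_mul_of_nonneg_left (hpt x b) (mul_nonneg (hw0 x) ((hπ x).1 b))
    _ = (∑ x, ∑ b, w x * π x b) * (2 * h) + 2 * h *
          ∑ x, ∑ b, w x * π x b * (g * |∑ x', (K' x b x' - K x b x') * V x'|) := by
        simp_rw [Finset.sum_mul, Finset.mul_sum _ _ (2 * h), ← Finset.sum_add_distrib]
        refine Finset.sum_congr rfl fun x _ => Finset.sum_congr rfl fun b _ => ?_
        ring
    _ = _ := by rw [hsum]; ring

end Discounted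

/-! ### Combinatorics of the binary trees -/

section TreeCombinatorics

variable {S A : Type*} [Fintype S]

theorem treeDepth_pos (S : Type*) [Fintype S] : 0 < treeDepth S :=
  lt_of_lt_of_le Nat.one_pos (le_max_left _ _)

theorem card_le_two_pow_treeDepth (S : Type*) [Fintype S] :
    Fintype.card S ≤ 2 ^ treeDepth S :=
  (Nat.le_pow_clog Nat.one_lt_two _).trans
    (Nat.pow_le_pow_right Nat.two_pos (le_max_right _ _))

theorem two_pow_treeDepth_le (S : Type*) [Fintype S] [Nonempty S] :
    2 ^ treeDepth S ≤ 2 * Fintype.card S := by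
  have h1 : 1 ≤ Fintype.card S := Fintype.card_pos
  unfold treeDepth
  rcases le_total (Nat.clog 2 (Fintype.card S)) 1 with h | h
  · rw [max_eq_left h]; omega
  · rw [max_eq_right h]
    have h2 : 2 ^ (Nat.clog 2 (Fintype.card S) - 1) < Fintype.card S := by
      rw [← Nat.lt_clog_iff_pow_lt Nat.one_lt_two]; omega
    calc 2 ^ Nat.clog 2 (Fintype.card S)
        = 2 * 2 ^ (Nat.clog 2 (Fintype.card S) - 1) := by
          rw [← pow_succ', Nat.sub_add_cancel h]
      _ ≤ _ := by omega

variable (e : S ≃ Fin (Fintype.card S))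

theorem blockIndex_zero (s : S) : blockIndex e 0 s = 0 :=
  Nat.div_eq_of_lt ((e s).2.trans_le (card_le_two_pow_treeDepth S))

theorem blockIndex_treeDepth (s : S) : blockIndex e (treeDepth S) s = e s := by
  simp [blockIndex]

theorem blockIndex_eq_div_two {k : ℕ} (hk : k < treeDepth S) (s : S) :
    blockIndex e k s = blockIndex e (k + 1) s / 2 := by
  unfold blockIndex
  rw [Nat.div_div_eq_div_mul, ← pow_succ]
  congr 2
  omega

theorem blockIndex_lt_two_pow {k : ℕ} (hk : k ≤ treeDepth S) (s : S) :
    blockIndex e k s < 2 ^ k := by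
  unfold blockIndex
  rw [Nat.div_lt_iff_lt_mul (by positivity), ← pow_add, Nat.add_sub_cancel' hk]
  exact (e s).2.trans_le (card_le_two_pow_treeDepth S)

/-- The inner vertices and the root of a tree together are fewer than twice the leaves. -/
theorem card_innerNode_add_one_le [Nonempty S] :
    Fintype.card (InnerNode e) + 1 ≤ 2 * Fintype.card S := by
  classical
  have hlt : ∀ q : InnerNode e, (q.1.2 : ℕ) < 2 ^ (q.1.1 : ℕ) := by
    rintro ⟨⟨k, j⟩, hk, s', hs'⟩
    have := blockIndex_lt_two_pow e k.2.le s'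
    exact lt_of_eq_of_lt hs'.symm this
  -- heap numbering: block `j` of depth `k` gets the number `2 ^ k + j`
  let φ : InnerNode e → ℕ := fun q => 2 ^ (q.1.1 : ℕ) + q.1.2
  have hlog : ∀ q, Nat.log 2 (φ q) = q.1.1 := by
    intro q
    rw [Nat.log_eq_iff (by right; exact ⟨Nat.one_lt_two, by positivity⟩)]
    refine ⟨Nat.le_add_right _ _, ?_⟩
    rw [pow_succ]
    have := hlt q
    simp only [φ]
    omega
  have hφ : Function.Injective φ := by
    intro q q' h
    have h1 : (q.1.1 : ℕ) = q'.1.1 := by rw [← hlog, ← hlog, h]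
    have h2 : (q.1.2 : ℕ) = q'.1.2 := by
      simp only [φ, h1] at h
      omega
    exact Subtype.ext (Prod.ext (Fin.ext h1) (Fin.ext h2))
  have hmem : ∀ q, φ q ∈ Finset.Ico 2 (2 ^ treeDepth S) := by
    intro q
    rw [Finset.mem_Ico]
    constructor
    · calc 2 = 2 ^ 1 := rfl
        _ ≤ 2 ^ (q.1.1 : ℕ) := Nat.pow_le_pow_right Nat.two_pos q.2.1
        _ ≤ _ := Nat.le_add_right _ _
    · calc φ q < 2 ^ (q.1.1 : ℕ) + 2 ^ (q.1.1 : ℕ) := Nat.add_lt_add_left (hlt q) _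
        _ = 2 ^ ((q.1.1 : ℕ) + 1) := by rw [pow_succ]; ring
        _ ≤ _ := Nat.pow_le_pow_right Nat.two_pos q.1.1.2
  have h1 := Finset.card_le_card_of_injOn φ (s := Finset.univ) (fun q _ => hmem q) hφ.injOn
  rw [Finset.card_univ, Nat.card_Ico] at h1
  have h2 := two_pow_treeDepth_le S
  have h3 : 2 ^ 1 ≤ 2 ^ treeDepth S := Nat.pow_le_pow_right Nat.two_pos (treeDepth_pos S)
  omega

theorem treePath_zero (s : S) (a : A) (s' : S) : treePath e s a s' 0 = Sum.inl s := by
  simp [treePath]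

theorem treePath_treeDepth (s : S) (a : A) (s' : S) :
    treePath e s a s' (treeDepth S) = Sum.inl s' := by
  simp [treePath, (treeDepth_pos S).ne']

/-- The inner vertex of depth `k` above the leaf `s'`. -/
def innerNode (k : ℕ) (h : 0 < k ∧ k < treeDepth S) (s' : S) : InnerNode e :=
  ⟨(⟨k, h.2⟩, ⟨blockIndex e k s', (Nat.div_le_self _ _).trans_lt (e s').2⟩), h.1, s', rfl⟩

theorem treePath_of_inner {k : ℕ} (h : 0 < k ∧ k < treeDepth S) (s : S) (a : A) (s' : S) :
    treePath e s a s' k = Sum.inr (s, a, innerNode e k h s') := by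
  rw [treePath, dif_pos h, innerNode]

theorem treePath_eq_iff {k : ℕ} (hk : k ≤ treeDepth S) (s : S) (a : A) (s' s'' : S) :
    treePath e s a s' k = treePath e s a s'' k ↔ blockIndex e k s' = blockIndex e k s'' := by
  rcases Nat.eq_zero_or_pos k with rfl | h0
  · simp [treePath_zero, blockIndex_zero]
  rcases hk.lt_or_eq with h1 | rfl
  · rw [treePath_of_inner e ⟨h0, h1⟩, treePath_of_inner e ⟨h0, h1⟩]
    refine ⟨fun h => ?_, fun h => ?_⟩
    · simp only [Sum.inr.injEq, Prod.mk.injEq] at h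
      exact congrArg (fun q : InnerNode e => (q.1.2 : ℕ)) h.2.2
    · congr 3
      exact Subtype.ext (Prod.ext rfl (Fin.ext h))
  · rw [treePath_treeDepth, treePath_treeDepth, blockIndex_treeDepth, blockIndex_treeDepth,
      Sum.inl.injEq, Fin.val_inj, e.apply_eq_iff_eq]

theorem treeLevel_lt (x : TreeState A e) : treeLevel e x < treeDepth S := by
  rcases x with s | ⟨s, a, q⟩
  · exact treeDepth_pos S
  · exact q.1.1.2

theorem treeLevel_treePath {k : ℕ} (hk : k < treeDepth S) (s : S) (a : A) (s' : S) :
    treeLevel e (treePath e s a s' k) = k := by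
  rcases Nat.eq_zero_or_pos k with rfl | h0
  · rw [treePath_zero]; rfl
  · rw [treePath_of_inner e ⟨h0, hk⟩]; rfl

theorem treeOrigin_treePath {k : ℕ} (hk : k < treeDepth S) (s : S) (a : A) (s' : S) :
    treeOrigin e (treePath e s a s' k) a = (s, a) := by
  rcases Nat.eq_zero_or_pos k with rfl | h0
  · rw [treePath_zero]; rfl
  · rw [treePath_of_inner e ⟨h0, hk⟩]; rfl

theorem isBelow_treePath {k : ℕ} (hk : k < treeDepth S) (s : S) (a : A) (s' : S) :
    IsBelow e (treePath e s a s' k) a s' := by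
  rw [IsBelow, treeOrigin_treePath e hk, treeLevel_treePath e hk]

theorem treeNext_treePath {k : ℕ} (hk : k < treeDepth S) (s : S) (a : A) (s' : S) :
    treeNext e (treePath e s a s' k) a s' = treePath e s a s' (k + 1) := by
  rw [treeNext, treeOrigin_treePath e hk, treeLevel_treePath e hk]

variable {e}

theorem isBelow_iff {x : TreeState A e} {b : A} {s' : S} (h : IsBelow e x b s') (s'' : S) :
    IsBelow e x b s'' ↔ blockIndex e (treeLevel e x) s'' = blockIndex e (treeLevel e x) s' := by
  rw [← treePath_eq_iff e (treeLevel_lt e x).le (treeOrigin e x b).1 (treeOrigin e x b).2]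
  unfold IsBelow at h ⊢
  rw [h]

theorem treeNext_eq_iff (x : TreeState A e) (b : A) (s' s'' : S) :
    treeNext e x b s'' = treeNext e x b s' ↔
      blockIndex e (treeLevel e x + 1) s'' = blockIndex e (treeLevel e x + 1) s' :=
  treePath_eq_iff e (treeLevel_lt e x) _ _ _ _

theorem isBelow_of_treeNext_eq {x : TreeState A e} {b : A} {s' s'' : S} (h : IsBelow e x b s')
    (h' : treeNext e x b s'' = treeNext e x b s') : IsBelow e x b s'' := by
  rw [isBelow_iff h, blockIndex_eq_div_two e (treeLevel_lt e x),
    blockIndex_eq_div_two e (treeLevel_lt e x), (treeNext_eq_iff x b s' s'').1 h']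

variable (e) in
/-- Mass under `p` of the leaves that share with `s'` the vertex of depth `k`. -/
def massBelow (p : S → ℝ) (k : ℕ) (s' : S) : ℝ :=
  ∑ s'', if blockIndex e k s'' = blockIndex e k s' then p s'' else 0

theorem massBelow_zero (p : S → ℝ) (s' : S) : massBelow e p 0 s' = ∑ s, p s := by
  simp [massBelow, blockIndex_zero]

theorem massBelow_treeDepth (p : S → ℝ) (s' : S) : massBelow e p (treeDepth S) s' = p s' := by
  classical
  simp [massBelow, blockIndex_treeDepth, Fin.val_inj]

theorem massBelow_nonneg {p : S → ℝ} (hp : ∀ s, 0 ≤ p s) (k : ℕ) (s' : S) :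
    0 ≤ massBelow e p k s' :=
  Finset.sum_nonneg fun s _ => by split_ifs <;> simp [hp]

theorem massBelow_succ_le {p : S → ℝ} (hp : ∀ s, 0 ≤ p s) {k : ℕ} (hk : k < treeDepth S)
    (s' : S) : massBelow e p (k + 1) s' ≤ massBelow e p k s' := by
  refine Finset.sum_le_sum fun s _ => ?_
  split_ifs with h1 h2 h2
  · exact le_rfl
  · exact absurd (by rw [blockIndex_eq_div_two e hk, h1, blockIndex_eq_div_two e hk]) h2
  · exact hp s
  · exact le_rfl

theorem treeKernel_eq_zero {P : S → A → S → ℝ} {x x' : TreeState A e} {b : A}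
    (h : x' ∉ treeSucc e x b) : treeKernel e P x b x' = 0 := by
  rw [treeKernel, Finset.sum_eq_zero, zero_div]
  intro s' _
  split_ifs with h1
  · rw [leafWeight, if_neg fun h2 => h ⟨s', h2, h1⟩]
  · rfl

theorem treeKernel_next {P : S → A → S → ℝ} {x : TreeState A e} {b : A} {s' : S}
    (h : IsBelow e x b s')
    (h0 : massBelow e (P (treeOrigin e x b).1 (treeOrigin e x b).2) (treeLevel e x) s' ≠ 0) :
    treeKernel e P x b (treeNext e x b s') =
      massBelow e (P (treeOrigin e x b).1 (treeOrigin e x b).2) (treeLevel e x + 1) s' /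
        massBelow e (P (treeOrigin e x b).1 (treeOrigin e x b).2) (treeLevel e x) s' := by
  classical
  set p := P (treeOrigin e x b).1 (treeOrigin e x b).2 with hp
  have hw : ∀ s'', leafWeight e P x b s'' = if IsBelow e x b s'' then p s'' else 0 := by
    intro s''
    have hex : ∃ t, IsBelow e x b t ∧ p t ≠ 0 := by
      by_contra! hne
      refine h0 (Finset.sum_eq_zero fun t _ => ?_)
      split_ifs with h1
      · exact hne t ((isBelow_iff h t).2 h1)
      · rfl
    rw [leafWeight, if_pos hex]
  rw [treeKernel]
  congr 1
  · refine Finset.sum_congr rfl fun s'' _ => ?_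
    simp only [hw, treeNext_eq_iff x b s' s'']
    split_ifs with h1 h2
    · rfl
    · exact absurd (isBelow_of_treeNext_eq h ((treeNext_eq_iff x b s' s'').2 h1)) h2
    · rfl
  · refine Finset.sum_congr rfl fun s'' _ => ?_
    simp only [hw, isBelow_iff h s'']

theorem massBelow_mul_treeKernel {P : S → A → S → ℝ} (hP : ∀ s a s', 0 ≤ P s a s') {k : ℕ}
    (hk : k < treeDepth S) (s : S) (a : A) (s' : S) :
    massBelow e (P s a) k s' *
        treeKernel e P (treePath e s a s' k) a (treePath e s a s' (k + 1)) =
      massBelow e (P s a) (k + 1) s' := by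
  by_cases h0 : massBelow e (P s a) k s' = 0
  · have h1 := massBelow_succ_le (e := e) (hP s a) hk s'
    have h2 := massBelow_nonneg (e := e) (hP s a) (k + 1) s'
    rw [h0, zero_mul]
    linarith
  · have h1 := treeKernel_next (P := P) (isBelow_treePath e hk s a s')
    rw [treeOrigin_treePath e hk, treeLevel_treePath e hk, treeNext_treePath e hk] at h1
    rw [h1 h0, mul_div_cancel₀ _ h0]

/-- In an added state the action has no effect. -/
theorem treeKernel_inr_action (P : S → A → S → ℝ) (z : S × A × InnerNode e) (b b' : A) :
    treeKernel e P (Sum.inr z) b = treeKernel e P (Sum.inr z) b' := rfl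

theorem exists_leaf_of_treeKernel_ne_zero {P : S → A → S → ℝ} {x x' : TreeState A e} {b : A}
    (h : treeKernel e P x b x' ≠ 0) : ∃ s', IsBelow e x b s' ∧ treeNext e x b s' = x' := by
  by_contra h'
  exact h (treeKernel_eq_zero h')

theorem treePath_succ_inj {i j : ℕ} (hi : i < treeDepth S) (hj : j < treeDepth S)
    {s t : S} {a c : A} {s' t' : S}
    (h : treePath e s a s' (i + 1) = treePath e t c t' (j + 1)) : i = j := by
  rcases (Nat.succ_le_of_lt hi).lt_or_eq with h1 | h1 <;>
    rcases (Nat.succ_le_of_lt hj).lt_or_eq with h2 | h2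
  · have h3 := congrArg (treeLevel e) h
    rw [treeLevel_treePath e h1, treeLevel_treePath e h2] at h3
    exact Nat.succ_injective h3
  · rw [Nat.succ_eq_add_one] at h2
    rw [h2, treePath_treeDepth, treePath_of_inner e ⟨Nat.succ_pos i, h1⟩] at h
    cases h
  · rw [Nat.succ_eq_add_one] at h1
    rw [h1, treePath_treeDepth, treePath_of_inner e ⟨Nat.succ_pos j, h2⟩] at h
    cases h
  · exact Nat.succ_injective (h1.trans h2.symm)

/-- The parent of a vertex in the tree of `(s, a)` is unique. -/
theorem eq_treePath_of_treeNext_eq {k : ℕ} (hk : k < treeDepth S) {s : S} {a : A} {s' s'' : S}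
    {y : TreeState A e} {b : A} (hy : treeOrigin e y b = (s, a)) (h : IsBelow e y b s'')
    (h' : treeNext e y b s'' = treePath e s a s' (k + 1)) : y = treePath e s a s' k := by
  rw [treeNext, hy] at h'
  have h1 := treePath_succ_inj (treeLevel_lt e y) hk h'
  rw [IsBelow, hy] at h
  rw [h1] at h h'
  rw [treePath_eq_iff e hk] at h'
  rw [← h, treePath_eq_iff e hk.le, blockIndex_eq_div_two e hk, h', blockIndex_eq_div_two e hk]

end TreeCombinatorics

/-! ### The flow equation of the transformed process -/

section TreeFlow

variable {S A : Type*} [Fintype S] [Fintype A] {e : S ≃ Fin (Fintype.card S)}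

theorem sum_treeState (F : TreeState A e → A → ℝ) :
    ∑ x, ∑ b, F x b = ∑ s, ∑ a, (F (Sum.inl s) a + ∑ q, ∑ b, F (Sum.inr (s, a, q)) b) := by
  rw [Fintype.sum_sum_type]
  simp_rw [Fintype.sum_prod_type, Finset.sum_add_distrib]

/-- Occupation measure of the vertex of depth `k` between `s` and `s'` in the tree of `(s, a)`.
At the root only the plays of `a` are counted. -/
def vertexMass (w : TreeState A e → ℝ) (π : TreeState A e → A → ℝ) (s : S) (a : A) (s' : S)
    (k : ℕ) : ℝ :=
  if k = 0 then w (Sum.inl s) * π (Sum.inl s) a else w (treePath e s a s' k)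

/-- The flow from the tree of `(s, a)` into a vertex comes from its parent. -/
theorem treeInflow_eq {P : S → A → S → ℝ} {π : TreeState A e → A → ℝ} (hπ : IsPolicy π)
    (w : TreeState A e → ℝ) {k : ℕ} (hk : k < treeDepth S) (s : S) (a : A) (s' : S) :
    w (Sum.inl s) * π (Sum.inl s) a * treeKernel e P (Sum.inl s) a (treePath e s a s' (k + 1)) +
      ∑ q, ∑ b, w (Sum.inr (s, a, q)) * π (Sum.inr (s, a, q)) b *
        treeKernel e P (Sum.inr (s, a, q)) b (treePath e s a s' (k + 1)) =
    vertexMass w π s a s' k *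
      treeKernel e P (treePath e s a s' k) a (treePath e s a s' (k + 1)) := by
  classical
  have hK : ∀ y b, treeOrigin e y b = (s, a) → y ≠ treePath e s a s' k →
      treeKernel e P y b (treePath e s a s' (k + 1)) = 0 := by
    intro y b hy hne
    by_contra h
    obtain ⟨s'', h1, h2⟩ := exists_leaf_of_treeKernel_ne_zero h
    exact hne (eq_treePath_of_treeNext_eq hk hy h1 h2)
  rcases Nat.eq_zero_or_pos k with rfl | h0
  · rw [Finset.sum_eq_zero, add_zero, vertexMass, if_pos rfl, treePath_zero]
    refine fun q _ => Finset.sum_eq_zero fun b _ => ?_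
    rw [hK _ b rfl (by rw [treePath_zero]; exact Sum.inr_ne_inl), mul_zero]
  · have hx := treePath_of_inner e ⟨h0, hk⟩ s a s'
    rw [hK (Sum.inl s) a rfl (by rw [hx]; exact Sum.inl_ne_inr), mul_zero, zero_add,
      vertexMass, if_neg h0.ne', Finset.sum_eq_single (innerNode e k ⟨h0, hk⟩ s'), hx]
    · simp_rw [treeKernel_inr_action P _ _ a]
      rw [← Finset.sum_mul, ← Finset.mul_sum, (hπ _).2, mul_one]
    · refine fun q _ hq => Finset.sum_eq_zero fun b _ => ?_
      rw [hK _ b rfl (by rw [hx]; simpa using hq), mul_zero]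
    · simp

theorem treeInflow_eq_zero {P : S → A → S → ℝ} {π : TreeState A e → A → ℝ}
    (w : TreeState A e → ℝ) {k : ℕ} (hk : k + 1 < treeDepth S) {s t : S} {a c : A} (s' : S)
    (h : (t, c) ≠ (s, a)) :
    w (Sum.inl t) * π (Sum.inl t) c * treeKernel e P (Sum.inl t) c (treePath e s a s' (k + 1)) +
      ∑ q, ∑ b, w (Sum.inr (t, c, q)) * π (Sum.inr (t, c, q)) b *
        treeKernel e P (Sum.inr (t, c, q)) b (treePath e s a s' (k + 1)) = 0 := by
  have hK : ∀ y b, treeOrigin e y b = (t, c) →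
      treeKernel e P y b (treePath e s a s' (k + 1)) = 0 := by
    intro y b hy
    by_contra h0
    obtain ⟨s'', h1, h2⟩ := exists_leaf_of_treeKernel_ne_zero h0
    rw [treeNext, hy] at h2
    have h3 := treePath_succ_inj (treeLevel_lt e y) (Nat.lt_of_succ_lt hk) h2
    rw [h3, treePath_of_inner e ⟨Nat.succ_pos k, hk⟩,
      treePath_of_inner e ⟨Nat.succ_pos k, hk⟩] at h2
    simp only [Sum.inr.injEq, Prod.mk.injEq] at h2
    exact h (by rw [h2.1, h2.2.1])
  rw [hK _ _ rfl, mul_zero, zero_add]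
  refine Finset.sum_eq_zero fun q _ => Finset.sum_eq_zero fun b _ => ?_
  rw [hK _ b rfl, mul_zero]

variable {dim : ℕ} {M : SICMDP S A dim} {π : TreeState A e → A → ℝ} {w : TreeState A e → ℝ}

/-- Under a flow of the transformed process, the vertex of depth `k` above `s'` in the tree of
`(s, a)` is visited as often as `a` is played in `s`, times the probability that the next state
lies below that vertex, up to discounting. -/
theorem vertexMass_eq (hπ : IsPolicy π)
    (hw : IsFlow (M.tree e).γ (M.tree e).μ (treeKernel e M.P) π w) {k : ℕ}
    (hk : k < treeDepth S) (s : S) (a : A) (s' : S) :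
    vertexMass w π s a s' k =
      (M.tree e).γ ^ k * (w (Sum.inl s) * π (Sum.inl s) a) * massBelow e (M.P s a) k s' := by
  classical
  induction k with
  | zero => rw [massBelow_zero, (M.P_mem s a).2, vertexMass, if_pos rfl, pow_zero, one_mul, mul_one]
  | succ k ih =>
    have hk' := Nat.lt_of_succ_lt hk
    rw [vertexMass, if_neg (Nat.succ_ne_zero k), hw, sum_treeState,
      Finset.sum_eq_single s, Finset.sum_eq_single a, treeInflow_eq hπ w hk', ih hk', mul_assoc,
      massBelow_mul_treeKernel (fun s a => (M.P_mem s a).1) hk']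
    · have h1 : (M.tree e).μ (treePath e s a s' (k + 1)) = 0 := by
        rw [treePath_of_inner e ⟨Nat.succ_pos k, hk⟩]; rfl
      rw [h1]
      ring
    · exact fun c _ hc => treeInflow_eq_zero w hk s' (by simp [hc])
    · simp
    · exact fun t _ ht => Finset.sum_eq_zero fun c _ => treeInflow_eq_zero w hk s' (by simp [ht])
    · simp

theorem tree_γ_pow_treeDepth (M : SICMDP S A dim) : (M.tree e).γ ^ treeDepth S = M.γ := by
  change (M.γ ^ (1 / (treeDepth S : ℝ))) ^ treeDepth S = M.γ
  rw [one_div]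
  exact Real.rpow_inv_natCast_pow M.γ_nonneg (treeDepth_pos S).ne'

/-- The restriction to the original states of a flow of the transformed process is a flow of the
original process. -/
theorem isFlow_restrict (hπ : IsPolicy π)
    (hw : IsFlow (M.tree e).γ (M.tree e).μ (treeKernel e M.P) π w) :
    IsFlow M.γ M.μ M.P (fun s => π (Sum.inl s)) (fun s => w (Sum.inl s)) := by
  intro s'
  obtain ⟨k, hk⟩ : ∃ k, treeDepth S = k + 1 := Nat.exists_eq_succ_of_ne_zero (treeDepth_pos S).ne'
  have hk' : k < treeDepth S := by omega
  have h1 : ∀ s a, (Sum.inl s' : TreeState A e) = treePath e s a s' (k + 1) := fun s a => by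
    rw [← hk, treePath_treeDepth]
  have h2 : (M.tree e).μ (Sum.inl s') = M.μ s' := rfl
  change w (Sum.inl s') = _
  rw [hw, sum_treeState, h2, ← tree_γ_pow_treeDepth (e := e) M, hk, pow_succ', mul_assoc]
  congr 2
  rw [Finset.mul_sum]
  refine Finset.sum_congr rfl fun s _ => ?_
  rw [Finset.mul_sum]
  refine Finset.sum_congr rfl fun a _ => ?_
  rw [h1 s a, treeInflow_eq hπ w hk', vertexMass_eq hπ hw hk', mul_assoc,
    massBelow_mul_treeKernel (fun s a => (M.P_mem s a).1) hk', ← hk, massBelow_treeDepth, mul_assoc]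

/-- A policy of the transformed process has there the value that its restriction has in the
original process. -/
theorem value_tree (M : SICMDP S A dim) (hπ : IsPolicy π) {f : S → A → ℝ}
    (hf : ∀ s a, f s a ∈ Set.Icc (0 : ℝ) 1) :
    (M.tree e).value (treeKernel e M.P) π (Sum.elim f fun _ _ => 0) =
      M.value M.P (fun s => π (Sum.inl s)) f := by
  obtain ⟨w, -, hw⟩ := exists_isFlow (M.tree e).γ_nonneg (M.tree e).γ_lt_one (M.tree e).μ_mem
    (M.tree e).P_mem hπ
  have hf' : ∀ (x : TreeState A e) b,
      Sum.elim f (fun _ _ => 0) x b ∈ Set.Icc (0 : ℝ) 1 := by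
    rintro (s | x) b
    · exact hf s b
    · simp
  have h1 := (M.tree e).value_eq_of_isFlow (M.tree e).P_mem hπ hf' hw
  change (M.tree e).value (treeKernel e M.P) _ _ = _ at h1
  rw [h1, M.value_eq_of_isFlow M.P_mem (fun s => hπ _) hf (isFlow_restrict hπ hw),
    sum_treeState]
  simp

/-- The transformation lengthens the effective horizon at most by the factor `treeDepth S`. -/
theorem tree_horizon_le (M : SICMDP S A dim) :
    1 / (1 - (M.tree e).γ) ≤ treeDepth S / (1 - M.γ) := by
  have h0 := (M.tree e).γ_nonneg
  have h1 := (M.tree e).γ_lt_one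
  have h2 := M.γ_lt_one
  rw [div_le_div_iff₀ (by linarith) (by linarith), one_mul, ← tree_γ_pow_treeDepth (e := e) M]
  have h3 := one_add_mul_sub_le_pow (a := (M.tree e).γ) (by linarith) (treeDepth S)
  linarith

end TreeFlow

/-! ### Transition counts in the transformed dataset -/

section Counts

open Classical in
/-- How many entries of `D` lie in `B`. -/
noncomputable def hitCount {α ι : Type*} [Fintype ι] (D : ι → α) (B : Finset α) : ℕ :=
  (Finset.univ.filter fun i => D i ∈ B).card

section PathStep

variable {S A ι : Type*} [Fintype S] {e : S ≃ Fin (Fintype.card S)}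

/-- The step of a path at which it plays `b` in the vertex `x`. -/
def pathStep (x : TreeState A e) (b : A) : Option (Fin (treeDepth S - 1) × A) :=
  match x with
  | Sum.inl _ => none
  | Sum.inr (_, _, q) => some (⟨q.1.1 - 1, by have := q.1.1.2; have := q.2.1; omega⟩, b)

theorem treeDataset_eq_iff (D : ι → S × A × S) (i : ι)
    (o : Option (Fin (treeDepth S - 1) × A)) (x : TreeState A e) (b : A) (x' : TreeState A e) :
    treeDataset e D (i, o) = (x, b, x') ↔ o = pathStep x b ∧
      (((D i).1, (D i).2.1) = treeOrigin e x b ∧ IsBelow e x b (D i).2.2) ∧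
        treeNext e x b (D i).2.2 = x' := by
  rcases o with _ | ⟨k, c⟩
  · change (treePath e (D i).1 (D i).2.1 (D i).2.2 0, (D i).2.1,
      treePath e (D i).1 (D i).2.1 (D i).2.2 1) = _ ↔ _
    rcases x with t | ⟨t, c, q⟩
    · simp only [treePath_zero, Prod.mk.injEq, Sum.inl.injEq, pathStep, true_and, treeOrigin,
        IsBelow, treeLevel, treeNext, and_true, zero_add, and_assoc]
      constructor
      · rintro ⟨rfl, rfl, h⟩
        exact ⟨rfl, rfl, h⟩
      · rintro ⟨rfl, rfl, h⟩
        exact ⟨rfl, rfl, h⟩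
    · simp [treePath_zero, pathStep]
  · have hk : 0 < (k : ℕ) + 1 ∧ (k : ℕ) + 1 < treeDepth S := ⟨by omega, by omega⟩
    change (treePath e (D i).1 (D i).2.1 (D i).2.2 (k + 1), c,
      treePath e (D i).1 (D i).2.1 (D i).2.2 (k + 2)) = _ ↔ _
    rcases x with t | ⟨t, c', q⟩
    · simp [treePath_of_inner e hk, pathStep]
    · simp only [Prod.mk.injEq, pathStep, Option.some.injEq, treeOrigin, IsBelow, treeLevel,
        treeNext, Fin.ext_iff]
      have hq : 0 < (q.1.1 : ℕ) := q.2.1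
      constructor
      · rintro ⟨h, rfl, rfl⟩
        have h1 := congrArg (treeLevel e) h
        rw [treeLevel_treePath e hk.2] at h1
        have h1' : (k : ℕ) + 1 = q.1.1 := h1
        have h2 := h
        rw [treePath_of_inner e hk] at h2
        simp only [Sum.inr.injEq, Prod.mk.injEq] at h2
        obtain ⟨rfl, rfl, -⟩ := h2
        rw [← h1']
        exact ⟨⟨rfl, rfl⟩, ⟨⟨rfl, rfl⟩, h⟩, rfl⟩
      · rintro ⟨⟨h1, rfl⟩, ⟨⟨rfl, rfl⟩, h2⟩, rfl⟩
        have h1' : (k : ℕ) + 1 = q.1.1 := by omega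
        rw [← h1'] at h2 ⊢
        exact ⟨h2, rfl, rfl⟩

end PathStep

variable {S A ι : Type*} [Fintype S] [Fintype A] [Fintype ι]

open Classical in
/-- The samples whose path runs through the vertex of depth `k` above `s'` in the tree of
`(s, a)`. -/
noncomputable def pathSet (e : S ≃ Fin (Fintype.card S)) (s : S) (a : A) (k : ℕ) (s' : S) :
    Finset (S × A × S) :=
  Finset.univ.filter fun z => z.1 = s ∧ z.2.1 = a ∧ blockIndex e k z.2.2 = blockIndex e k s'

variable {e : S ≃ Fin (Fintype.card S)}

theorem mem_pathSet {s : S} {a : A} {k : ℕ} {s' : S} {z : S × A × S} :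
    z ∈ pathSet e s a k s' ↔
      z.1 = s ∧ z.2.1 = a ∧ blockIndex e k z.2.2 = blockIndex e k s' := by
  simp [pathSet]

theorem pathSet_succ_subset {k : ℕ} (hk : k < treeDepth S) (s : S) (a : A) (s' : S) :
    pathSet e s a (k + 1) s' ⊆ pathSet e s a k s' := fun z hz => by
  rw [mem_pathSet] at hz ⊢
  exact ⟨hz.1, hz.2.1, by rw [blockIndex_eq_div_two e hk, hz.2.2, blockIndex_eq_div_two e hk]⟩

open Classical in
theorem transCount_treeDataset (D : ι → S × A × S) (x : TreeState A e) (b : A)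
    (x' : TreeState A e) :
    transCount (treeDataset e D) x b x' = hitCount D (Finset.univ.filter fun z : S × A × S =>
      ((z.1, z.2.1) = treeOrigin e x b ∧ IsBelow e x b z.2.2) ∧ treeNext e x b z.2.2 = x') := by
  rw [transCount, hitCount]
  have h1 : Function.Injective fun i : ι => (i, pathStep x b) := fun i j h => congrArg Prod.fst h
  rw [← Finset.card_image_of_injective _ h1]
  congr 1
  ext ⟨i, o⟩
  simp only [Finset.mem_filter, Finset.mem_univ, true_and, treeDataset_eq_iff, Finset.mem_image,
    Prod.mk.injEq]
  constructor
  · rintro ⟨rfl, h⟩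
    exact ⟨i, h, rfl, rfl⟩
  · rintro ⟨j, h, rfl, rfl⟩
    exact ⟨rfl, h⟩

theorem transCount_treeDataset_next (D : ι → S × A × S) {x : TreeState A e} {b : A} {s' : S}
    (h : IsBelow e x b s') :
    transCount (treeDataset e D) x b (treeNext e x b s') =
      hitCount D (pathSet e (treeOrigin e x b).1 (treeOrigin e x b).2 (treeLevel e x + 1) s') := by
  rw [transCount_treeDataset]
  congr 1
  ext z
  simp only [Finset.mem_filter, Finset.mem_univ, true_and, mem_pathSet, treeNext_eq_iff,
    Prod.ext_iff]
  constructor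
  · exact fun h1 => ⟨h1.1.1.1, h1.1.1.2, h1.2⟩
  · exact fun h1 => ⟨⟨⟨h1.1, h1.2.1⟩,
      isBelow_of_treeNext_eq h ((treeNext_eq_iff x b s' _).2 h1.2.2)⟩, h1.2.2⟩

theorem transCount_treeDataset_eq_zero (D : ι → S × A × S) {x x' : TreeState A e} {b : A}
    (h : x' ∉ treeSucc e x b) : transCount (treeDataset e D) x b x' = 0 := by
  by_contra h0
  rw [transCount_treeDataset, hitCount] at h0
  obtain ⟨i, hi⟩ := Finset.card_pos.1 (Nat.pos_of_ne_zero h0)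
  simp only [Finset.mem_filter, Finset.mem_univ, true_and] at hi
  exact h ⟨_, hi.1.2, hi.2⟩

open Classical in
theorem visitCount_treeDataset (D : ι → S × A × S) {x : TreeState A e} {b : A} {s' : S}
    (h : IsBelow e x b s') :
    visitCount (treeDataset e D) x b =
      hitCount D (pathSet e (treeOrigin e x b).1 (treeOrigin e x b).2 (treeLevel e x) s') := by
  rw [visitCount, hitCount, Finset.card_eq_sum_card_fiberwise
    (f := fun i => treeNext e x b (D i).2.2) (t := Finset.univ) (fun _ _ => Finset.mem_univ _)]
  refine Finset.sum_congr rfl fun x' _ => ?_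
  rw [transCount_treeDataset, hitCount]
  congr 1
  ext i
  simp only [Finset.mem_filter, Finset.mem_univ, true_and, mem_pathSet, isBelow_iff h,
    Prod.ext_iff, and_assoc]

end Counts

/-! ### Concentration for independent samples with random sample sizes -/

section Concentration

variable {α : Type*} [Fintype α]

open Classical in
/-- Probability of `E` for `m` independent draws from the weights `wt`. -/
noncomputable def iidProb (wt : α → ℝ) (m : ℕ) (E : Set (Fin m → α)) : ℝ :=
  ∑ D : Fin m → α, if D ∈ E then ∏ i, wt (D i) else 0

variable {wt : α → ℝ} {m : ℕ}

theorem iidProb_univ (h1 : ∑ z, wt z = 1) : iidProb wt m Set.univ = 1 := by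
  have h2 := Finset.prod_univ_sum (fun _ : Fin m => (Finset.univ : Finset α)) (fun _ z => wt z)
  simp only [h1, Finset.prod_const_one, Fintype.piFinset_univ] at h2
  simp [iidProb, ← h2]

theorem iidProb_nonneg (h0 : ∀ z, 0 ≤ wt z) (E : Set (Fin m → α)) : 0 ≤ iidProb wt m E := by
  refine Finset.sum_nonneg fun D _ => ?_
  split_ifs
  · exact Finset.prod_nonneg fun i _ => h0 _
  · exact le_rfl

theorem iidProb_mono (h0 : ∀ z, 0 ≤ wt z) {E F : Set (Fin m → α)} (h : E ⊆ F) :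
    iidProb wt m E ≤ iidProb wt m F := by
  refine Finset.sum_le_sum fun D _ => ?_
  have h2 : 0 ≤ ∏ i, wt (D i) := Finset.prod_nonneg fun i _ => h0 _
  by_cases hE : D ∈ E
  · rw [if_pos hE, if_pos (h hE)]
  · rw [if_neg hE]
    split_ifs
    · exact h2
    · exact le_rfl

theorem iidProb_union_le (h0 : ∀ z, 0 ≤ wt z) (E F : Set (Fin m → α)) :
    iidProb wt m (E ∪ F) ≤ iidProb wt m E + iidProb wt m F := by
  unfold iidProb
  rw [← Finset.sum_add_distrib]
  refine Finset.sum_le_sum fun D _ => ?_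
  have h2 : 0 ≤ ∏ i, wt (D i) := Finset.prod_nonneg fun i _ => h0 _
  by_cases hE : D ∈ E <;> by_cases hF : D ∈ F <;> simp [hE, hF, h2]

theorem iidProb_exists_le {J : Type*} (h0 : ∀ z, 0 ≤ wt z) (s : Finset J)
    (E : J → Set (Fin m → α)) {η : ℝ} (hE : ∀ j ∈ s, iidProb wt m (E j) ≤ η) :
    iidProb wt m {D | ∃ j ∈ s, D ∈ E j} ≤ s.card * η := by
  classical
  induction s using Finset.induction_on with
  | empty => simp [iidProb]
  | insert j s hj ih =>
    have h1 : {D : Fin m → α | ∃ i ∈ insert j s, D ∈ E i} = E j ∪ {D | ∃ i ∈ s, D ∈ E i} := by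
      ext D; simp
    rw [h1, Finset.card_insert_of_notMem hj]
    push_cast
    linarith [iidProb_union_le h0 (E j) {D | ∃ i ∈ s, D ∈ E i}, hE j (Finset.mem_insert_self j s),
      ih fun i hi => hE i (Finset.mem_insert_of_mem hi)]

theorem one_sub_iidProb_compl_le (h0 : ∀ z, 0 ≤ wt z) (h1 : ∑ z, wt z = 1)
    (E : Set (Fin m → α)) : 1 - iidProb wt m Eᶜ ≤ iidProb wt m E := by
  have h2 := iidProb_union_le h0 E Eᶜ
  rw [Set.union_compl_self, iidProb_univ h1] at h2
  linarith

/-- Markov's inequality. -/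
theorem iidProb_le_sum (h0 : ∀ z, 0 ≤ wt z) {E : Set (Fin m → α)} {F : (Fin m → α) → ℝ}
    (hF0 : ∀ D, 0 ≤ F D) (hF : ∀ D ∈ E, 1 ≤ F D) :
    iidProb wt m E ≤ ∑ D : Fin m → α, F D * ∏ i, wt (D i) := by
  refine Finset.sum_le_sum fun D _ => ?_
  have h2 : 0 ≤ ∏ i, wt (D i) := Finset.prod_nonneg fun i _ => h0 _
  split_ifs with h
  · exact le_mul_of_one_le_left h2 (hF D h)
  · exact mul_nonneg (hF0 D) h2

theorem prod_ite_mem_eq_pow {α : Type*} {m : ℕ} {B : Finset α} [DecidablePred (· ∈ B)]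
    (D : Fin m → α) (c : ℝ) :
    ∏ i, (if D i ∈ B then c else 1) = c ^ hitCount D B := by
  classical
  rw [Finset.prod_ite, Finset.prod_const, Finset.prod_const_one, mul_one, hitCount]
  congr!

/-- Chernoff bound for the lower tail of the number of hits. -/
theorem iidProb_hitCount_le (h0 : ∀ z, 0 ≤ wt z) (h1 : ∑ z, wt z = 1) (B : Finset α) {q : ℝ}
    (hq : ∑ z ∈ B, wt z = q) :
    iidProb wt m {D | (hitCount D B : ℝ) < m * q / 2} ≤ Real.exp (-(m * q / 8)) := by
  classical
  -- the exponent `-log 2` is used, and `1 / 2 - 3 / 8 = 1 / 8`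
  have hlog : Real.log 2 ≤ 3 / 4 := by linarith [Real.log_two_lt_d9]
  have hq0 : 0 ≤ q := hq ▸ Finset.sum_nonneg fun z _ => h0 z
  refine (iidProb_le_sum h0 (F := fun D => Real.exp (3 / 8 * (m * q)) * (1 / 2) ^ hitCount D B)
    (fun D => by positivity) fun D hD => ?_).trans ?_
  · have h2 : ((1 : ℝ) / 2) ^ hitCount D B = Real.exp (-(Real.log 2 * hitCount D B)) := by
      rw [Real.exp_neg, Real.exp_mul, Real.exp_log two_pos, Real.rpow_natCast, one_div, inv_pow]
    rw [h2, ← Real.exp_add]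
    refine Real.one_le_exp ?_
    have h3 : (hitCount D B : ℝ) < m * q / 2 := hD
    have h4 : (0 : ℝ) ≤ hitCount D B := Nat.cast_nonneg _
    nlinarith
  · have h2 : ∀ D : Fin m → α, Real.exp (3 / 8 * (m * q)) * (1 / 2) ^ hitCount D B *
        ∏ i, wt (D i) = Real.exp (3 / 8 * (m * q)) *
          ∏ i, ((if D i ∈ B then (1 / 2 : ℝ) else 1) * wt (D i)) := by
      intro D
      rw [Finset.prod_mul_distrib, prod_ite_mem_eq_pow, mul_assoc]
    have h3 := Finset.prod_univ_sum (fun _ : Fin m => (Finset.univ : Finset α))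
      (fun _ z => (if z ∈ B then (1 / 2 : ℝ) else 1) * wt z)
    rw [Fintype.piFinset_univ] at h3
    simp_rw [h2]
    rw [← Finset.mul_sum, ← h3, Finset.prod_const, Finset.card_univ, Fintype.card_fin]
    have h4 : ∑ z, (if z ∈ B then (1 / 2 : ℝ) else 1) * wt z = 1 - q / 2 := by
      have h5 : ∀ z, (if z ∈ B then (1 / 2 : ℝ) else 1) * wt z
          = wt z - 1 / 2 * (if z ∈ B then wt z else 0) := by
        intro z; split_ifs <;> ring
      simp_rw [h5, Finset.sum_sub_distrib, ← Finset.mul_sum, h1]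
      rw [Finset.sum_ite_mem, Finset.univ_inter, hq]
      ring
    have h6 : q ≤ 1 := by
      rw [← hq, ← h1]
      exact Finset.sum_le_sum_of_subset_of_nonneg (Finset.subset_univ B) fun z _ _ => h0 z
    have h7 : (1 - q / 2) ^ m ≤ Real.exp (-(q / 2)) ^ m :=
      pow_le_pow_left₀ (by linarith) (Real.one_sub_le_exp_neg _) m
    rw [h4]
    calc Real.exp (3 / 8 * (m * q)) * (1 - q / 2) ^ m
        ≤ Real.exp (3 / 8 * (m * q)) * Real.exp (-(q / 2)) ^ m :=
          mul_le_mul_of_nonneg_left h7 (Real.exp_pos _).le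
      _ = Real.exp (-(m * q / 8)) := by
          rw [← Real.exp_nat_mul, ← Real.exp_add]
          congr 1
          ring

/-- Moment generating function at `l` of a centred Bernoulli variable with parameter `p`. -/
noncomputable def bernoulliMGF (p l : ℝ) : ℝ :=
  (1 - p) * Real.exp (l * (0 - p)) + p * Real.exp (l * (1 - p))

/-- Chernoff's method for the hits of `G` among the hits of `B`, whose number is random. Given
which draws hit `B`, these are independent draws of `G` with the conditional probability `p`, so
that the exponents may depend on the number of hits of `B`. -/
theorem iidProb_chernoff_le (h0 : ∀ z, 0 ≤ wt z) (h1 : ∑ z, wt z = 1) {B G : Finset α}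
    (hGB : G ⊆ B) {p η : ℝ} (hp : ∑ z ∈ G, wt z = p * ∑ z ∈ B, wt z) (l τ : ℕ → ℝ)
    (h : ∀ n, 0 < n → Real.exp (-τ n) * bernoulliMGF p (l n) ^ n ≤ η) (hη : 0 ≤ η) :
    iidProb wt m {D | 0 < hitCount D B ∧
      τ (hitCount D B) ≤ l (hitCount D B) * (hitCount D G - hitCount D B * p)} ≤ η := by
  classical
  -- the datasets are split according to the set of the draws that hit `B`
  let T : Finset (Fin m) → Fin m → Finset α := fun I i => if i ∈ I then B else Bᶜ
  let I : (Fin m → α) → Finset (Fin m) := fun D => Finset.univ.filter fun i => D i ∈ B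
  have hI : ∀ D, hitCount D B = (I D).card := fun D => by simp only [hitCount, I]
  have hT : ∀ J D, I D = J ↔ D ∈ Fintype.piFinset (T J) := by
    intro J D
    rw [Fintype.mem_piFinset]
    constructor
    · rintro rfl i
      by_cases hi : D i ∈ B <;> simp [T, I, hi]
    · intro hD
      ext i
      have := hD i
      by_cases hi : i ∈ J <;> simpa [T, I, hi] using this
  have hfib : ∀ F : (Fin m → α) → ℝ,
      ∑ D, F D = ∑ J, ∑ D ∈ Fintype.piFinset (T J), F D := by
    intro F
    rw [← Finset.sum_fiberwise (s := Finset.univ) (g := I)]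
    refine Finset.sum_congr rfl fun J _ => Finset.sum_congr ?_ fun _ _ => rfl
    ext D
    simp [hT]
  have hη' : η = η * ∑ J, ∑ D ∈ Fintype.piFinset (T J), ∏ i, wt (D i) := by
    have h2 := iidProb_univ (m := m) h1
    simp only [iidProb, Set.mem_univ, if_true] at h2
    rw [← hfib, h2, mul_one]
  rw [hη', iidProb, hfib, Finset.mul_sum]
  refine Finset.sum_le_sum fun J _ => ?_
  have hpos : 0 ≤ ∑ D ∈ Fintype.piFinset (T J), ∏ i, wt (D i) :=
    Finset.sum_nonneg fun D _ => Finset.prod_nonneg fun i _ => h0 _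
  rcases J.eq_empty_or_nonempty with rfl | hJ
  · rw [Finset.sum_eq_zero]
    · exact mul_nonneg hη hpos
    · intro D hD
      have h3 := (hT _ _).2 hD
      rw [if_neg]
      simp [hI, h3]
  set n := J.card with hn
  have hn0 : 0 < n := hJ.card_pos
  let u : α → ℝ := fun z =>
    if z ∈ B then Real.exp (l n * ((if z ∈ G then 1 else 0) - p)) else 1
  have hu : ∀ D ∈ Fintype.piFinset (T J),
      ∏ i, u (D i) = Real.exp (l n * (hitCount D G - hitCount D B * p)) := by
    intro D _
    have h3 : ∀ i, u (D i) = Real.exp (l n * ((if D i ∈ G then 1 else 0)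
        - (if D i ∈ B then 1 else 0) * p)) := by
      intro i
      by_cases hB : D i ∈ B
      · simp [u, hB]
      · have hG : D i ∉ G := fun hG => hB (hGB hG)
        simp [u, hB, hG]
    simp_rw [h3]
    rw [← Real.exp_sum, ← Finset.mul_sum, Finset.sum_sub_distrib, ← Finset.sum_mul, hitCount,
      hitCount, Finset.sum_boole, Finset.sum_boole]
  have hsum : ∑ D ∈ Fintype.piFinset (T J), ∏ i, (u (D i) * wt (D i))
      = bernoulliMGF p (l n) ^ n * ∑ D ∈ Fintype.piFinset (T J), ∏ i, wt (D i) := by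
    rw [← Finset.prod_univ_sum (T J) (fun _ z => u z * wt z),
      ← Finset.prod_univ_sum (T J) (fun _ z => wt z)]
    have h3 : ∀ i, ∑ z ∈ T J i, u z * wt z =
        (if i ∈ J then bernoulliMGF p (l n) else 1) * ∑ z ∈ T J i, wt z := by
      intro i
      by_cases hi : i ∈ J
      · simp only [T, hi, if_true]
        have h4 : ∀ z ∈ B, u z * wt z = Real.exp (l n * (0 - p)) * wt z
            + (Real.exp (l n * (1 - p)) - Real.exp (l n * (0 - p)))
              * (if z ∈ G then wt z else 0) := by
          intro z hz
          by_cases hG : z ∈ G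
          · simp [u, hz, hG]
            ring
          · simp [u, hz, hG]
        rw [Finset.sum_congr rfl h4, Finset.sum_add_distrib, ← Finset.mul_sum, ← Finset.mul_sum,
          Finset.sum_ite_mem, Finset.inter_eq_right.2 hGB, hp, bernoulliMGF]
        ring
      · simp only [T, hi, if_false, one_mul]
        refine Finset.sum_congr rfl fun z hz => ?_
        rw [Finset.mem_compl] at hz
        simp [u, hz]
    simp_rw [h3]
    rw [Finset.prod_mul_distrib]
    congr 1
    rw [Finset.prod_ite, Finset.prod_const, Finset.prod_const_one, mul_one]
    simp [hn]
  calc _ ≤ ∑ D ∈ Fintype.piFinset (T J), Real.exp (-τ n) * ∏ i, (u (D i) * wt (D i)) := by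
        refine Finset.sum_le_sum fun D hD => ?_
        have h4 : 0 ≤ ∏ i, wt (D i) := Finset.prod_nonneg fun i _ => h0 _
        have hND : hitCount D B = n := by rw [hI, (hT _ _).2 hD]
        rw [Finset.prod_mul_distrib, hu D hD, ← mul_assoc, ← Real.exp_add]
        split_ifs with h3
        · refine le_mul_of_one_le_left h4 (Real.one_le_exp ?_)
          have h5 := h3.2
          rw [hND] at h5 ⊢
          linarith
        · exact mul_nonneg (Real.exp_pos _).le h4
    _ = (Real.exp (-τ n) * bernoulliMGF p (l n) ^ n) *
          ∑ D ∈ Fintype.piFinset (T J), ∏ i, wt (D i) := by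
        rw [← Finset.mul_sum, hsum, mul_assoc]
    _ ≤ _ := mul_le_mul_of_nonneg_right (h n hn0) hpos

theorem iidProb_two_sided_le (h0 : ∀ z, 0 ≤ wt z) (h1 : ∑ z, wt z = 1) {B G : Finset α}
    (hGB : G ⊆ B) {p η : ℝ} (hp : ∑ z ∈ G, wt z = p * ∑ z ∈ B, wt z) (t : ℕ → ℝ)
    (h : ∀ n, 0 < n → ∃ l, 0 ≤ l ∧
      Real.exp (-(l * (n * t n))) * bernoulliMGF p l ^ n ≤ η ∧
      Real.exp (-(l * (n * t n))) * bernoulliMGF p (-l) ^ n ≤ η) (hη : 0 ≤ η) :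
    iidProb wt m {D | 0 < hitCount D B ∧
      t (hitCount D B) < |(hitCount D G / hitCount D B : ℝ) - p|} ≤ 2 * η := by
  choose! l hl0 hl1 hl2 using h
  have hA := iidProb_chernoff_le (m := m) h0 h1 hGB hp l (fun n => l n * (n * t n))
    (fun n hn => hl1 n hn) hη
  have hB := iidProb_chernoff_le (m := m) h0 h1 hGB hp (fun n => -l n) (fun n => l n * (n * t n))
    (fun n hn => hl2 n hn) hη
  refine (iidProb_mono h0 ?_).trans ((iidProb_union_le h0 _ _).trans
    ((add_le_add hA hB).trans_eq (two_mul η).symm))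
  rintro D ⟨hn, hD⟩
  have hn' : (0 : ℝ) < hitCount D B := Nat.cast_pos.2 hn
  have h2 : (hitCount D G : ℝ) - hitCount D B * p =
      hitCount D B * ((hitCount D G / hitCount D B : ℝ) - p) := by
    field_simp
  rcases lt_abs.1 hD with h3 | h3
  · refine Or.inl ⟨hn, ?_⟩
    rw [h2]
    exact mul_le_mul_of_nonneg_left (mul_le_mul_of_nonneg_left h3.le hn'.le) (hl0 _ hn)
  · refine Or.inr ⟨hn, ?_⟩
    rw [h2, neg_mul, ← mul_neg, ← mul_neg]
    exact mul_le_mul_of_nonneg_left (mul_le_mul_of_nonneg_left h3.le hn'.le) (hl0 _ hn)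

theorem bernoulliMGF_nonneg {p : ℝ} (hp : p ∈ Set.Icc (0 : ℝ) 1) (l : ℝ) :
    0 ≤ bernoulliMGF p l :=
  add_nonneg (mul_nonneg (by linarith [hp.2]) (Real.exp_pos _).le)
    (mul_nonneg hp.1 (Real.exp_pos _).le)

/-- Hoeffding's lemma for Bernoulli variables. -/
theorem bernoulliMGF_le_hoeffding {p : ℝ} (hp : p ∈ Set.Icc (0 : ℝ) 1) (l : ℝ) :
    bernoulliMGF p l ≤ Real.exp (l ^ 2 / 8) := by
  obtain ⟨hp0, hp1⟩ := hp
  let μ : MeasureTheory.Measure ℝ := ENNReal.ofReal (1 - p) • MeasureTheory.Measure.dirac 0 +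
    ENNReal.ofReal p • MeasureTheory.Measure.dirac 1
  have hint : ∀ F : ℝ → ℝ, ∫ x, F x ∂μ = (1 - p) * F 0 + p * F 1 := by
    intro F
    rw [MeasureTheory.integral_add_measure
      ((MeasureTheory.integrable_dirac (by simp)).smul_measure ENNReal.ofReal_ne_top)
      ((MeasureTheory.integrable_dirac (by simp)).smul_measure ENNReal.ofReal_ne_top),
      MeasureTheory.integral_smul_measure, MeasureTheory.integral_smul_measure,
      MeasureTheory.integral_dirac, MeasureTheory.integral_dirac,
      ENNReal.toReal_ofReal (by linarith), ENNReal.toReal_ofReal hp0]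
    rfl
  have hprob : MeasureTheory.IsProbabilityMeasure μ := by
    refine ⟨?_⟩
    simp only [μ, MeasureTheory.Measure.add_apply, MeasureTheory.Measure.smul_apply,
      MeasureTheory.measure_univ, smul_eq_mul, mul_one]
    rw [← ENNReal.ofReal_add (by linarith) hp0]
    simp
  have hmem : ∀ᵐ x ∂μ, (id x : ℝ) ∈ Set.Icc (0 : ℝ) 1 := by
    rw [MeasureTheory.ae_add_measure_iff]
    exact ⟨MeasureTheory.Measure.ae_smul_measure (by simp [MeasureTheory.ae_dirac_eq]) _,
      MeasureTheory.Measure.ae_smul_measure (by simp [MeasureTheory.ae_dirac_eq]) _⟩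
  have h1 := (ProbabilityTheory.hasSubgaussianMGF_of_mem_Icc aemeasurable_id hmem).mgf_le l
  rw [ProbabilityTheory.mgf, hint] at h1
  have h2 : ∫ x, id x ∂μ = p := by rw [hint]; simp
  rw [h2] at h1
  refine h1.trans (Real.exp_le_exp.2 (le_of_eq ?_))
  norm_num
  ring

theorem exp_le_of_abs_le {x l : ℝ} (hx : |x| ≤ l) (hl : l < 1) :
    Real.exp x ≤ 1 + x + x ^ 2 / (2 * (1 - l)) := by
  have h1 := Real.exp_bound (hx.trans hl.le) (n := 3) (by norm_num)
  norm_num [Finset.sum_range_succ, Nat.factorial] at h1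
  have h2 := (abs_le.1 h1).2
  have h3 : x ^ 2 / 2 + |x| ^ 3 * (2 / 9) ≤ x ^ 2 / (2 * (1 - l)) := by
    rw [le_div_iff₀ (by linarith), ← sq_abs x]
    have := abs_nonneg x
    nlinarith [pow_nonneg this 3, pow_nonneg this 2,
      mul_le_mul_of_nonneg_right hx (pow_nonneg this 2)]
  linarith

/-- Bernstein's bound on the moment generating function, in sub-gamma form. -/
theorem bernoulliMGF_le_bernstein {p l b : ℝ} (hp : p ∈ Set.Icc (0 : ℝ) 1) (hl : |l| ≤ b)
    (hb : b < 1) : bernoulliMGF p l ≤ Real.exp (p * (1 - p) * (l ^ 2 / (2 * (1 - b)))) := by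
  obtain ⟨hp0, hp1⟩ := hp
  have h1 : |l * (0 - p)| ≤ b := by
    rw [abs_mul, zero_sub, abs_neg, abs_of_nonneg hp0]
    nlinarith [abs_nonneg l]
  have h2 : |l * (1 - p)| ≤ b := by
    rw [abs_mul, abs_of_nonneg (sub_nonneg.2 hp1)]
    nlinarith [abs_nonneg l]
  have h3 := mul_le_mul_of_nonneg_left (exp_le_of_abs_le h1 hb) (sub_nonneg.2 hp1)
  have h4 := mul_le_mul_of_nonneg_left (exp_le_of_abs_le h2 hb) hp0
  have h5 : bernoulliMGF p l ≤ 1 + p * (1 - p) * (l ^ 2 / (2 * (1 - b))) := by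
    refine (add_le_add h3 h4).trans_eq ?_
    have : (1 - b) ≠ 0 := by linarith
    field_simp
    ring
  have h6 := Real.add_one_le_exp (p * (1 - p) * (l ^ 2 / (2 * (1 - b))))
  linarith

/-- The exponent that turns Chernoff's bound into Hoeffding's inequality. -/
theorem exists_hoeffding_exponent {p ℓ : ℝ} (hp : p ∈ Set.Icc (0 : ℝ) 1) (hℓ : 0 ≤ ℓ) {n : ℕ}
    (hn : 0 < n) : ∃ l, 0 ≤ l ∧
      Real.exp (-(l * (n * Real.sqrt (ℓ / (2 * n))))) * bernoulliMGF p l ^ n ≤ Real.exp (-ℓ) ∧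
      Real.exp (-(l * (n * Real.sqrt (ℓ / (2 * n))))) * bernoulliMGF p (-l) ^ n ≤
        Real.exp (-ℓ) := by
  have hn' : (0 : ℝ) < n := Nat.cast_pos.2 hn
  set t := Real.sqrt (ℓ / (2 * n)) with ht
  have ht2 : t ^ 2 = ℓ / (2 * n) := Real.sq_sqrt (by positivity)
  have key : ∀ l, l ^ 2 = (4 * t) ^ 2 →
      Real.exp (-(4 * t * (n * t))) * bernoulliMGF p l ^ n ≤ Real.exp (-ℓ) := by
    intro l hl
    calc Real.exp (-(4 * t * (n * t))) * bernoulliMGF p l ^ n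
        ≤ Real.exp (-(4 * t * (n * t))) * Real.exp (l ^ 2 / 8) ^ n :=
          mul_le_mul_of_nonneg_left (pow_le_pow_left₀ (bernoulliMGF_nonneg hp l)
            (bernoulliMGF_le_hoeffding hp l) n) (Real.exp_pos _).le
      _ = Real.exp (-ℓ) := by
          rw [← Real.exp_nat_mul, ← Real.exp_add, hl]
          congr 1
          have : ℓ = 2 * n * t ^ 2 := by rw [ht2]; field_simp
          rw [this]
          ring
  exact ⟨4 * t, by positivity, key _ rfl, key _ (neg_sq _)⟩

/-- The exponent that turns Chernoff's bound into Bernstein's inequality. With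
`a = √(2 ℓ / (n p (1 - p)))` it is `a / (1 + a)`. -/
theorem exists_bernstein_exponent {p ℓ : ℝ} (hp : p ∈ Set.Icc (0 : ℝ) 1) (hℓ : 0 < ℓ) {n : ℕ}
    (hn : 0 < n) : ∃ l, 0 ≤ l ∧
      Real.exp (-(l * (n * (Real.sqrt (2 * p * (1 - p) * ℓ / n) + ℓ / n)))) *
        bernoulliMGF p l ^ n ≤ Real.exp (-ℓ) ∧
      Real.exp (-(l * (n * (Real.sqrt (2 * p * (1 - p) * ℓ / n) + ℓ / n)))) *
        bernoulliMGF p (-l) ^ n ≤ Real.exp (-ℓ) := by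
  have hn' : (0 : ℝ) < n := Nat.cast_pos.2 hn
  rcases (mul_nonneg hp.1 (sub_nonneg.2 hp.2)).eq_or_lt with hv | hv
  · -- a deterministic variable: the moment generating function is constant
    refine ⟨1, zero_le_one, ?_⟩
    have h1 : ∀ l, bernoulliMGF p l = 1 := by
      intro l
      rcases mul_eq_zero.1 hv.symm with h | h
      · simp [bernoulliMGF, h]
      · have : p = 1 := by linarith
        simp [bernoulliMGF, this]
    have h2 : n * (Real.sqrt (2 * p * (1 - p) * ℓ / n) + ℓ / n) = ℓ := by
      rw [show 2 * p * (1 - p) * ℓ / n = 0 by rw [mul_assoc 2, ← hv]; simp]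
      rw [Real.sqrt_zero, zero_add]
      field_simp
    rw [h2]
    simp [h1]
  · set v := p * (1 - p) with hvdef
    set κ := ℓ / n with hκ
    have hκ0 : 0 < κ := by positivity
    set a := Real.sqrt (2 * κ / v) with ha
    have ha0 : 0 < a := Real.sqrt_pos.2 (by positivity)
    have ha2 : v * a ^ 2 = 2 * κ := by
      rw [ha, Real.sq_sqrt (by positivity)]
      field_simp
    have hs : Real.sqrt (2 * p * (1 - p) * ℓ / n) = v * a := by
      rw [Real.sqrt_eq_iff_mul_self_eq_of_pos (by positivity)]
      rw [mul_assoc 2, ← hvdef, mul_div_assoc, ← hκ]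
      linear_combination v * ha2
    have hb : a / (1 + a) < 1 := by rw [div_lt_one (by positivity)]; linarith
    have key : ∀ l, |l| = a / (1 + a) → Real.exp (-(a / (1 + a) * (n * (v * a + κ)))) *
        bernoulliMGF p l ^ n ≤ Real.exp (-ℓ) := by
      intro l hl
      calc _ ≤ Real.exp (-(a / (1 + a) * (n * (v * a + κ)))) *
            Real.exp (v * (l ^ 2 / (2 * (1 - a / (1 + a))))) ^ n :=
            mul_le_mul_of_nonneg_left (pow_le_pow_left₀ (bernoulliMGF_nonneg hp l)
              (bernoulliMGF_le_bernstein hp hl.le hb) n) (Real.exp_pos _).le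
        _ = Real.exp (-ℓ) := by
            rw [← Real.exp_nat_mul, ← Real.exp_add, ← sq_abs l, hl]
            congr 1
            have h3 : ℓ = n * κ := by rw [hκ]; field_simp
            have h4 : 1 - a / (1 + a) = 1 / (1 + a) := by field_simp; ring
            have h5 : κ = v * a ^ 2 / 2 := by linarith
            rw [h4, h3, h5]
            field_simp
            ring
    rw [hs]
    refine ⟨a / (1 + a), by positivity, key _ (abs_of_pos (by positivity)), key _ ?_⟩
    rw [abs_neg, abs_of_pos (by positivity)]

end Concentration

/-! ### The confidence event -/

section ConfidenceEvent

/-- Replacing the true variance by the empirical one in Bernstein's bound. -/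
theorem empirical_bernstein {p p' κ : ℝ} (hp' : p' ∈ Set.Icc (0 : ℝ) 1) (hp : p ∈ Set.Icc (0 : ℝ) 1)
    (hκ : 0 ≤ κ) (h : |p' - p| ≤ Real.sqrt (2 * p * (1 - p) * κ) + κ) :
    |p' - p| ≤ Real.sqrt (2 * p' * (1 - p') * κ) + 4 * κ := by
  set t := |p' - p| with ht
  have ht0 : 0 ≤ t := abs_nonneg _
  rcases le_total t (4 * κ) with h1 | h1
  · linarith [Real.sqrt_nonneg (2 * p' * (1 - p') * κ)]
  have hv : p * (1 - p) ≤ p' * (1 - p') + t := by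
    have h2 : p * (1 - p) - p' * (1 - p') = (p' - p) * (p' + p - 1) := by ring
    have h3 : (p' - p) * (p' + p - 1) ≤ t * 1 := by
      refine (le_abs_self _).trans ?_
      rw [abs_mul]
      refine mul_le_mul_of_nonneg_left ?_ ht0
      rw [abs_le]
      constructor <;> linarith [hp.1, hp.2, hp'.1, hp'.2]
    linarith
  have h0 : 0 ≤ 2 * p * (1 - p) * κ :=
    mul_nonneg (mul_nonneg (by linarith [hp.1]) (by linarith [hp.2])) hκ
  have h2 : (t - κ) ^ 2 ≤ 2 * p * (1 - p) * κ := by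
    rw [← Real.sq_sqrt h0]
    exact pow_le_pow_left₀ (by linarith) (by linarith) 2
  have h3 := mul_le_mul_of_nonneg_right hv hκ
  have h4 : t - 4 * κ ≤ Real.sqrt (2 * p' * (1 - p') * κ) := by
    refine Real.le_sqrt_of_sq_le ?_
    nlinarith [mul_le_mul_of_nonneg_left h1 hκ]
  linarith

/-- A parameter in the confidence interval is close to the true one, in terms of the true
variance. -/
theorem abs_sub_le_of_confidence {p p' p'' κ : ℝ} (hp' : p' ∈ Set.Icc (0 : ℝ) 1)
    (hp : p ∈ Set.Icc (0 : ℝ) 1) (hκ : 0 ≤ κ)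
    (h : |p' - p| ≤ Real.sqrt (2 * p * (1 - p) * κ) + κ)
    (h' : |p'' - p'| ≤ Real.sqrt (4 * p' * (1 - p') * κ) + 8 * κ) :
    |p'' - p| ≤ 5 * Real.sqrt (p * (1 - p) * κ) + 11 * κ := by
  set t := |p' - p| with ht
  have ht0 : 0 ≤ t := abs_nonneg _
  set r := Real.sqrt (p * (1 - p) * κ) with hr
  have hr0 : 0 ≤ r := Real.sqrt_nonneg _
  have hr2 : r ^ 2 = p * (1 - p) * κ :=
    Real.sq_sqrt (mul_nonneg (mul_nonneg hp.1 (sub_nonneg.2 hp.2)) hκ)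
  have hv : p' * (1 - p') ≤ p * (1 - p) + t := by
    have h2 : p' * (1 - p') - p * (1 - p) = (p' - p) * (1 - p' - p) := by ring
    have h3 : (p' - p) * (1 - p' - p) ≤ t * 1 := by
      refine (le_abs_self _).trans ?_
      rw [abs_mul]
      refine mul_le_mul_of_nonneg_left ?_ ht0
      rw [abs_le]
      constructor <;> linarith [hp.1, hp.2, hp'.1, hp'.2]
    linarith
  have h1 : Real.sqrt (2 * p * (1 - p) * κ) ≤ 3 / 2 * r := by
    rw [Real.sqrt_le_left (by positivity)]
    nlinarith
  have h3 := mul_le_mul_of_nonneg_right hv hκ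
  have h2 : Real.sqrt (4 * p' * (1 - p') * κ) ≤ 2 * r + t + κ := by
    rw [Real.sqrt_le_left (by positivity)]
    nlinarith [sq_nonneg (t - κ), mul_nonneg hr0 ht0, mul_nonneg hr0 hκ]
  have h4 : |p'' - p| ≤ |p'' - p'| + t := abs_sub_le _ _ _
  linarith

variable {S A : Type*} [Fintype S] [Fintype A] {dim : ℕ}

/-- Probability that one sample runs through the vertex of depth `k` above `s'` in the tree of
`(s, a)`. -/
noncomputable def SICMDP.pathProb (M : SICMDP S A dim) (e : S ≃ Fin (Fintype.card S))
    (ν : S × A → ℝ) (s : S) (a : A) (k : ℕ) (s' : S) : ℝ :=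
  ν (s, a) * massBelow e (M.P s a) k s'

/-- The law of a single sample. -/
def SICMDP.sampleWeight (M : SICMDP S A dim) (ν : S × A → ℝ) (z : S × A × S) : ℝ :=
  ν (z.1, z.2.1) * M.P z.1 z.2.1 z.2.2

/-- The conditional probability of the next vertex on the way to `s'`, given the vertex of
depth `k`. -/
noncomputable def SICMDP.stepProb (M : SICMDP S A dim) (e : S ≃ Fin (Fintype.card S))
    (s : S) (a : A) (k : ℕ) (s' : S) : ℝ :=
  massBelow e (M.P s a) (k + 1) s' / massBelow e (M.P s a) k s'

/-- The empirical frequency of every step in a tree satisfies Hoeffding's and Bernstein's bound,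
and only steps from vertices of positive probability occur. -/
def SICMDP.StepEvent (M : SICMDP S A dim) (e : S ≃ Fin (Fintype.card S)) (δ : ℝ) {m : ℕ}
    (D : Fin m → S × A × S) : Prop :=
  ∀ s a k s', k < treeDepth S → 0 < hitCount D (pathSet e s a k s') →
    0 < massBelow e (M.P s a) k s' ∧
    |(hitCount D (pathSet e s a (k + 1) s') / hitCount D (pathSet e s a k s') : ℝ) -
      M.stepProb e s a k s'| ≤
        Real.sqrt (Real.log (2 / δ) / (2 * hitCount D (pathSet e s a k s'))) ∧
    |(hitCount D (pathSet e s a (k + 1) s') / hitCount D (pathSet e s a k s') : ℝ) -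
      M.stepProb e s a k s'| ≤
        Real.sqrt (2 * M.stepProb e s a k s' * (1 - M.stepProb e s a k s') * Real.log (4 / δ) /
          hitCount D (pathSet e s a k s')) +
          Real.log (4 / δ) / hitCount D (pathSet e s a k s')

/-- Every vertex that is expected to be visited often is visited at least half as often as
expected. -/
def SICMDP.VisitEvent (M : SICMDP S A dim) (e : S ≃ Fin (Fintype.card S)) (ν : S × A → ℝ)
    (δ : ℝ) {m : ℕ} (D : Fin m → S × A × S) : Prop :=
  ∀ s a k s', k < treeDepth S → 8 * Real.log (4 / δ) ≤ m * M.pathProb e ν s a k s' →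
    m * M.pathProb e ν s a k s' / 2 ≤ hitCount D (pathSet e s a k s')

variable (M : SICMDP S A dim) (e : S ≃ Fin (Fintype.card S)) {ν : S × A → ℝ}

theorem SICMDP.sampleWeight_nonneg (hν : ν ∈ stdSimplex ℝ (S × A)) (z : S × A × S) :
    0 ≤ M.sampleWeight ν z :=
  mul_nonneg (hν.1 _) ((M.P_mem _ _).1 _)

theorem SICMDP.sum_sampleWeight (hν : ν ∈ stdSimplex ℝ (S × A)) :
    ∑ z, M.sampleWeight ν z = 1 := by
  simp only [sampleWeight, Fintype.sum_prod_type, ← Finset.mul_sum, (M.P_mem _ _).2, mul_one]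
  rw [← hν.2, Fintype.sum_prod_type]

theorem SICMDP.sum_pathSet (s : S) (a : A) (k : ℕ) (s' : S) :
    ∑ z ∈ pathSet e s a k s', M.sampleWeight ν z = M.pathProb e ν s a k s' := by
  classical
  rw [pathSet, Finset.sum_filter, Fintype.sum_prod_type, Finset.sum_eq_single s,
    Fintype.sum_prod_type, Finset.sum_eq_single a]
  · simp only [sampleWeight, pathProb, massBelow, Finset.mul_sum, true_and, mul_ite, mul_zero]
  · intro c _ hc
    simp [hc]
  · simp
  · intro t _ ht
    simp [ht]
  · simp

theorem massBelow_eq_zero_succ {p : S → ℝ} (hp : ∀ s, 0 ≤ p s) {k : ℕ}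
    (hk : k < treeDepth S) {s' : S} (h : massBelow e p k s' = 0) :
    massBelow e p (k + 1) s' = 0 :=
  le_antisymm (h ▸ massBelow_succ_le hp hk s') (massBelow_nonneg hp _ _)

theorem SICMDP.stepProb_mem {k : ℕ} (hk : k < treeDepth S) (s : S) (a : A) (s' : S) :
    M.stepProb e s a k s' ∈ Set.Icc (0 : ℝ) 1 :=
  ⟨div_nonneg (massBelow_nonneg (M.P_mem s a).1 _ _) (massBelow_nonneg (M.P_mem s a).1 _ _),
    div_le_one_of_le₀ (massBelow_succ_le (M.P_mem s a).1 hk s')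
      (massBelow_nonneg (M.P_mem s a).1 _ _)⟩

theorem iidProb_hit_null {α : Type*} [Fintype α] {wt : α → ℝ} (h0 : ∀ z, 0 ≤ wt z) {m : ℕ}
    {B : Finset α} (hB : ∑ z ∈ B, wt z = 0) : iidProb wt m {D | 0 < hitCount D B} = 0 := by
  refine Finset.sum_eq_zero fun D _ => ?_
  split_ifs with h
  · obtain ⟨i, hi⟩ := Finset.card_pos.1 h
    simp only [Finset.mem_filter, Finset.mem_univ, true_and] at hi
    exact Finset.prod_eq_zero (Finset.mem_univ i)
      ((Finset.sum_eq_zero_iff_of_nonneg fun z _ => h0 z).1 hB _ hi)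
  · rfl

/-- Failure probability of the bounds at a single vertex. -/
theorem SICMDP.iidProb_vertex_le (hν : ν ∈ stdSimplex ℝ (S × A)) {δ : ℝ} (hδ0 : 0 < δ)
    (hδ1 : δ < 2) {m k : ℕ} (hk : k < treeDepth S) (s : S) (a : A) (s' : S) :
    iidProb (M.sampleWeight ν) m {D | ¬ ((0 < hitCount D (pathSet e s a k s') →
      0 < massBelow e (M.P s a) k s' ∧
      |(hitCount D (pathSet e s a (k + 1) s') / hitCount D (pathSet e s a k s') : ℝ) -
        M.stepProb e s a k s'| ≤
          Real.sqrt (Real.log (2 / δ) / (2 * hitCount D (pathSet e s a k s'))) ∧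
      |(hitCount D (pathSet e s a (k + 1) s') / hitCount D (pathSet e s a k s') : ℝ) -
        M.stepProb e s a k s'| ≤
          Real.sqrt (2 * M.stepProb e s a k s' * (1 - M.stepProb e s a k s') * Real.log (4 / δ) /
            hitCount D (pathSet e s a k s')) +
            Real.log (4 / δ) / hitCount D (pathSet e s a k s')) ∧
      (8 * Real.log (4 / δ) ≤ m * M.pathProb e ν s a k s' →
        m * M.pathProb e ν s a k s' / 2 ≤ hitCount D (pathSet e s a k s')))} ≤ 7 / 4 * δ := by
  set B := pathSet e s a k s' with hB
  set G := pathSet e s a (k + 1) s' with hG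
  set p := M.stepProb e s a k s' with hp
  set q := M.pathProb e ν s a k s' with hq
  have h0 := M.sampleWeight_nonneg hν
  have h1 := M.sum_sampleWeight hν
  have hmem := M.stepProb_mem e hk s a s'
  have hL2 : 0 < Real.log (2 / δ) := Real.log_pos (by rw [lt_div_iff₀ hδ0]; linarith)
  have hL4 : 0 < Real.log (4 / δ) := Real.log_pos (by rw [lt_div_iff₀ hδ0]; linarith)
  have hexp2 : Real.exp (-Real.log (2 / δ)) = δ / 2 := by
    rw [Real.exp_neg, Real.exp_log (by positivity), inv_div]
  have hexp4 : Real.exp (-Real.log (4 / δ)) = δ / 4 := by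
    rw [Real.exp_neg, Real.exp_log (by positivity), inv_div]
  have hGB : G ⊆ B := pathSet_succ_subset hk s a s'
  have hpq : ∑ z ∈ G, M.sampleWeight ν z = p * ∑ z ∈ B, M.sampleWeight ν z := by
    rw [M.sum_pathSet, M.sum_pathSet, pathProb, pathProb, hp, stepProb]
    by_cases h : massBelow e (M.P s a) k s' = 0
    · rw [h, massBelow_eq_zero_succ e (M.P_mem s a).1 hk h]; simp
    · field_simp
  have hA1 := iidProb_two_sided_le (m := m) h0 h1 hGB hpq
    (fun n => Real.sqrt (Real.log (2 / δ) / (2 * n)))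
    (fun n hn => exists_hoeffding_exponent hmem hL2.le hn) (Real.exp_pos _).le
  have hA2 := iidProb_two_sided_le (m := m) h0 h1 hGB hpq
    (fun n => Real.sqrt (2 * p * (1 - p) * Real.log (4 / δ) / n) + Real.log (4 / δ) / n)
    (fun n hn => exists_bernstein_exponent hmem hL4 hn) (Real.exp_pos _).le
  have hA3 : iidProb (M.sampleWeight ν) m {D | 8 * Real.log (4 / δ) ≤ m * q ∧
      (hitCount D B : ℝ) < m * q / 2} ≤ Real.exp (-Real.log (4 / δ)) := by
    by_cases h : 8 * Real.log (4 / δ) ≤ m * q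
    · refine (iidProb_mono h0 fun D hD => hD.2).trans
        ((iidProb_hitCount_le h0 h1 B (M.sum_pathSet e s a k s')).trans ?_)
      exact Real.exp_le_exp.2 (by linarith)
    · refine le_trans (le_of_eq ?_) (Real.exp_pos _).le
      simp [iidProb, h]
  have hA4 : iidProb (M.sampleWeight ν) m
      {D | 0 < hitCount D B ∧ ¬ 0 < massBelow e (M.P s a) k s'} ≤ 0 := by
    by_cases h : 0 < massBelow e (M.P s a) k s'
    · simp [iidProb, h]
    · have h2 : massBelow e (M.P s a) k s' = 0 :=
        le_antisymm (not_lt.1 h) (massBelow_nonneg (M.P_mem s a).1 _ _)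
      refine (iidProb_mono h0 fun D hD => hD.1).trans (iidProb_hit_null h0 ?_).le
      rw [M.sum_pathSet, pathProb, h2, mul_zero]
  rw [hexp2] at hA1
  rw [hexp4] at hA2 hA3
  refine (iidProb_mono h0 ?_).trans ((iidProb_union_le h0 _ _).trans (add_le_add
    ((iidProb_union_le h0 _ _).trans (add_le_add hA1 hA2))
    ((iidProb_union_le h0 _ _).trans (add_le_add hA3 hA4)))) |>.trans_eq (by ring)
  intro D hD
  by_contra hD'
  simp only [Set.mem_union, Set.mem_ofPred_eq, not_or, not_and, not_lt] at hD'
  obtain ⟨⟨h2, h3⟩, h4, h5⟩ := hD'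
  exact hD ⟨fun hn => ⟨not_le.1 (h5 hn), h2 hn, h3 hn⟩, h4⟩

theorem treeDepth_le_card (S : Type*) [Fintype S] [Nonempty S] :
    treeDepth S ≤ Fintype.card S := by
  refine max_le Fintype.card_pos ?_
  exact (Nat.clog_le_iff_le_pow Nat.one_lt_two).2 Nat.lt_two_pow_self.le

/-- The union bound over all vertices of all trees. -/
theorem SICMDP.one_sub_le_datasetProb (hν : ν ∈ stdSimplex ℝ (S × A)) {δ : ℝ} (hδ0 : 0 < δ)
    (hδ1 : δ < 1) {m : ℕ} {E : Set (Fin m → S × A × S)}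
    (hE : ∀ D, M.StepEvent e
        (δ / (2 * (Fintype.card S : ℝ) ^ 4 * (Fintype.card A : ℝ) ^ 3)) D →
      M.VisitEvent e ν (δ / (2 * (Fintype.card S : ℝ) ^ 4 * (Fintype.card A : ℝ) ^ 3)) D →
      D ∈ E) : 1 - δ ≤ M.datasetProb ν m E := by
  have hne : Nonempty (S × A) := by
    by_contra h
    rw [not_nonempty_iff] at h
    simpa using hν.2
  have hS : Nonempty S := ⟨hne.some.1⟩
  have hA : Nonempty A := ⟨hne.some.2⟩
  have hcS : (1 : ℝ) ≤ Fintype.card S := by exact_mod_cast Fintype.card_pos (α := S)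
  have hcA : (1 : ℝ) ≤ Fintype.card A := by exact_mod_cast Fintype.card_pos (α := A)
  have hd : (treeDepth S : ℝ) ≤ Fintype.card S := by exact_mod_cast treeDepth_le_card S
  set cS : ℝ := (Fintype.card S : ℝ) with hcS_def
  set cA : ℝ := (Fintype.card A : ℝ) with hcA_def
  set δ' := δ / (2 * cS ^ 4 * cA ^ 3) with hδ'
  have hδ'0 : 0 < δ' := by positivity
  have hδ'1 : δ' < 2 := by
    rw [hδ', div_lt_iff₀ (by positivity)]
    have := one_le_pow₀ hcS (n := 4)
    have := one_le_pow₀ hcA (n := 3)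
    nlinarith
  have h0 := M.sampleWeight_nonneg hν
  have h1 := iidProb_exists_le (m := m) h0 (Finset.univ : Finset (S × A × Fin (treeDepth S) × S)) _
    (fun j _ => M.iidProb_vertex_le e hν hδ'0 hδ'1 (m := m) j.2.2.1.2 j.1 j.2.1 j.2.2.2)
  have h2 : ((Finset.univ : Finset (S × A × Fin (treeDepth S) × S)).card : ℝ) *
      (7 / 4 * δ') ≤ δ := by
    simp only [Finset.card_univ, Fintype.card_prod, Fintype.card_fin, Nat.cast_mul]
    rw [← hcS_def, ← hcA_def]
    have h3 : cS * (cA * (treeDepth S * cS)) * (7 / 4) ≤ 2 * cS ^ 4 * cA ^ 3 := by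
      have h4 : (treeDepth S : ℝ) ≤ cS ^ 2 := hd.trans (by nlinarith)
      have h5 : cA ≤ cA ^ 3 := le_self_pow₀ hcA (by norm_num)
      calc cS * (cA * (treeDepth S * cS)) * (7 / 4)
          ≤ cS * (cA ^ 3 * (cS ^ 2 * cS)) * (7 / 4) := by gcongr
        _ = 7 / 4 * (cS ^ 4 * cA ^ 3) := by ring
        _ ≤ 2 * (cS ^ 4 * cA ^ 3) := by gcongr; norm_num
        _ = _ := by ring
    calc cS * (cA * (treeDepth S * cS)) * (7 / 4 * δ')
        = cS * (cA * (treeDepth S * cS)) * (7 / 4) * δ' := by ring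
      _ ≤ 2 * cS ^ 4 * cA ^ 3 * δ' := mul_le_mul_of_nonneg_right h3 hδ'0.le
      _ = δ := by rw [hδ']; field_simp
  have h3 : M.datasetProb ν m E = iidProb (M.sampleWeight ν) m E := rfl
  have h4 := one_sub_iidProb_compl_le (m := m) h0 (M.sum_sampleWeight hν) E
  rw [h3]
  refine le_trans ?_ h4
  refine sub_le_sub_left ((iidProb_mono h0 ?_).trans (h1.trans h2)) 1
  intro D hD
  by_contra hD'
  simp only [Set.mem_ofPred_eq, Finset.mem_univ, true_and, not_exists, not_not] at hD'
  exact hD (hE D (fun s a k s' hk => (hD' (s, a, ⟨k, hk⟩, s')).1)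
    (fun s a k s' hk => (hD' (s, a, ⟨k, hk⟩, s')).2))

end ConfidenceEvent

/-! ### One-step errors on the confidence event -/

section OneStep

theorem sum_mul_eq_of_support {X : Type*} [Fintype X] {p F : X → ℝ} {c₁ c₂ : X} (h12 : c₁ ≠ c₂)
    (hp : ∀ x, x ≠ c₁ → x ≠ c₂ → p x = 0) : ∑ x, p x * F x = p c₁ * F c₁ + p c₂ * F c₂ := by
  classical
  rw [← Finset.sum_pair (f := fun x => p x * F x) h12]
  refine (Finset.sum_subset (Finset.subset_univ _) fun x _ hx => ?_).symm
  simp only [Finset.mem_insert, Finset.mem_singleton, not_or] at hx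
  rw [hp x hx.1 hx.2, zero_mul]

/-- If there are only two possible next states, the error of the expected next value is governed
by the variance of the next value: no union bound over value functions is needed. -/
theorem abs_sum_sub_mul_le {X : Type*} [Fintype X] {p p' V : X → ℝ} {c₁ c₂ : X}
    (h12 : c₁ ≠ c₂) (hp : p ∈ stdSimplex ℝ X) (hp' : p' ∈ stdSimplex ℝ X)
    (hsp : ∀ x, x ≠ c₁ → x ≠ c₂ → p x = 0) (hsp' : ∀ x, x ≠ c₁ → x ≠ c₂ → p' x = 0)
    {h κ a b : ℝ} (hV : ∀ x, V x ∈ Set.Icc 0 h) (hκ : 0 ≤ κ) (hb : 0 ≤ b)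
    (hclose : |p' c₁ - p c₁| ≤ a * Real.sqrt (p c₁ * (1 - p c₁) * κ) + b) :
    |∑ x, (p' x - p x) * V x| ≤ a * Real.sqrt (κ * vecVar p V) + b * h := by
  have hs : p c₁ + p c₂ = 1 := by
    have := sum_mul_eq_of_support (F := fun _ => 1) h12 hsp
    simpa [hp.2] using this.symm
  have hs' : p' c₁ + p' c₂ = 1 := by
    have := sum_mul_eq_of_support (F := fun _ => 1) h12 hsp'
    simpa [hp'.2] using this.symm
  have h2 : p c₂ = 1 - p c₁ := by linarith
  have h2' : p' c₂ = 1 - p' c₁ := by linarith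
  have hdiff : ∑ x, (p' x - p x) * V x = (p' c₁ - p c₁) * (V c₁ - V c₂) := by
    rw [sum_mul_eq_of_support h12 fun x hx hx' => by rw [hsp x hx hx', hsp' x hx hx', sub_zero],
      h2, h2']
    ring
  have hvar : vecVar p V = p c₁ * (1 - p c₁) * (V c₁ - V c₂) ^ 2 := by
    rw [vecVar, sum_mul_eq_of_support h12 hsp, sum_mul_eq_of_support h12 hsp, h2]
    ring
  have hsqrt : Real.sqrt (κ * vecVar p V) =
      Real.sqrt (p c₁ * (1 - p c₁) * κ) * |V c₁ - V c₂| := by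
    rw [hvar, ← Real.sqrt_sq_eq_abs, ← Real.sqrt_mul]
    · congr 1; ring
    · exact mul_nonneg (mul_nonneg (hp.1 _) (by linarith [hp.1 c₂])) hκ
  have hVd : |V c₁ - V c₂| ≤ h := by
    rw [abs_le]
    constructor <;> linarith [(hV c₁).1, (hV c₁).2, (hV c₂).1, (hV c₂).2]
  rw [hdiff, abs_mul, hsqrt]
  calc |p' c₁ - p c₁| * |V c₁ - V c₂|
      ≤ (a * Real.sqrt (p c₁ * (1 - p c₁) * κ) + b) * |V c₁ - V c₂| :=
        mul_le_mul_of_nonneg_right hclose (abs_nonneg _)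
    _ = a * (Real.sqrt (p c₁ * (1 - p c₁) * κ) * |V c₁ - V c₂|) + b * |V c₁ - V c₂| := by ring
    _ ≤ _ := by gcongr

/-- Every vertex has at most two children. -/
theorem treeNext_eq_or_of_isBelow {S A : Type*} [Fintype S] {e : S ≃ Fin (Fintype.card S)}
    {x : TreeState A e} {b : A} {s₁ s₂ s' : S}
    (h₁ : IsBelow e x b s₁) (h₂ : IsBelow e x b s₂) (h12 : treeNext e x b s₁ ≠ treeNext e x b s₂)
    (h' : IsBelow e x b s') :
    treeNext e x b s' = treeNext e x b s₁ ∨ treeNext e x b s' = treeNext e x b s₂ := by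
  have hk := treeLevel_lt e x
  rw [Ne, treeNext_eq_iff] at h12
  rw [treeNext_eq_iff, treeNext_eq_iff]
  rw [isBelow_iff h₁, blockIndex_eq_div_two e hk, blockIndex_eq_div_two e hk] at h₂ h'
  omega

variable {S A : Type*} [Fintype S] [Fintype A] {dim : ℕ} {M : SICMDP S A dim}
  {e : S ≃ Fin (Fintype.card S)} {δ : ℝ} {m : ℕ} {D : Fin m → S × A × S}

/-- The bounds of `SICMDP.StepEvent` in terms of the transformed process. -/
theorem SICMDP.StepEvent.bounds (h : M.StepEvent e δ D) {x : TreeState A e} {b : A} {s' : S}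
    (hx : IsBelow e x b s') (hn : 0 < visitCount (treeDataset e D) x b) :
    empKernel (treeDataset e D) x b (treeNext e x b s') =
      (transCount (treeDataset e D) x b (treeNext e x b s') : ℝ) /
        visitCount (treeDataset e D) x b ∧
    |empKernel (treeDataset e D) x b (treeNext e x b s') -
      treeKernel e M.P x b (treeNext e x b s')| ≤
        Real.sqrt (Real.log (2 / δ) / (2 * visitCount (treeDataset e D) x b)) ∧
    |empKernel (treeDataset e D) x b (treeNext e x b s') -
      treeKernel e M.P x b (treeNext e x b s')| ≤
        Real.sqrt (2 * treeKernel e M.P x b (treeNext e x b s') *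
          (1 - treeKernel e M.P x b (treeNext e x b s')) *
            (Real.log (4 / δ) / visitCount (treeDataset e D) x b)) +
          Real.log (4 / δ) / visitCount (treeDataset e D) x b := by
  have h1 := h (treeOrigin e x b).1 (treeOrigin e x b).2 (treeLevel e x) s' (treeLevel_lt e x)
  rw [← visitCount_treeDataset D hx, ← transCount_treeDataset_next D hx] at h1
  obtain ⟨h2, h3, h4⟩ := h1 hn
  have h5 := treeKernel_next (P := M.P) hx h2.ne'
  rw [SICMDP.stepProb, ← h5] at h3 h4
  have h6 : empKernel (treeDataset e D) x b (treeNext e x b s') =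
      (transCount (treeDataset e D) x b (treeNext e x b s') : ℝ) /
        visitCount (treeDataset e D) x b := by
    rw [empKernel, max_eq_right (by exact_mod_cast hn)]
  rw [mul_div_assoc] at h4
  rw [h6]
  exact ⟨rfl, h3, h4⟩

theorem transCount_le_visitCount {S A ι : Type*} [Fintype S] [Fintype ι] (D : ι → S × A × S)
    (s : S) (a : A) (s' : S) : transCount D s a s' ≤ visitCount D s a :=
  Finset.single_le_sum (f := fun t => transCount D s a t) (fun _ _ => Nat.zero_le _)
    (Finset.mem_univ s')

theorem empKernel_mem {S A ι : Type*} [Fintype S] [Fintype ι] (D : ι → S × A × S)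
    (s : S) (a : A) (s' : S) : empKernel D s a s' ∈ Set.Icc (0 : ℝ) 1 := by
  refine ⟨div_nonneg (Nat.cast_nonneg _) (by positivity), div_le_one_of_le₀ ?_ (by positivity)⟩
  exact le_max_of_le_right (by exact_mod_cast transCount_le_visitCount D s a s')

theorem stdSimplex_apply_mem_Icc {ι : Type*} [Fintype ι] {p : ι → ℝ} (hp : p ∈ stdSimplex ℝ ι)
    (x : ι) : p x ∈ Set.Icc (0 : ℝ) 1 :=
  ⟨hp.1 x, hp.2 ▸ Finset.single_le_sum (fun y _ => hp.1 y) (Finset.mem_univ x)⟩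

/-- On the confidence event, the true transition probabilities belong to the optimistic set. -/
theorem SICMDP.StepEvent.treeKernel_mem_confSet (h : M.StepEvent e δ D) (hδ0 : 0 < δ)
    (hδ1 : δ ≤ 1) :
    treeKernel e M.P ∈ confSet (treeDataset e D) (treeSucc e) δ := by
  intro x b
  refine ⟨treeKernel_mem e M.P_mem x b, fun x' hx' => treeKernel_eq_zero hx', fun x' hpos => ?_⟩
  have hsucc : x' ∈ treeSucc e x b := by
    by_contra hx'
    exact hpos.ne' (transCount_treeDataset_eq_zero D hx')
  obtain ⟨s', hx, rfl⟩ := hsucc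
  have hle := transCount_le_visitCount (treeDataset e D) x b (treeNext e x b s')
  obtain ⟨-, h2, h3⟩ := h.bounds hx (hpos.trans_le hle)
  have hL2 : 0 ≤ Real.log (2 / δ) := Real.log_nonneg (by rw [le_div_iff₀ hδ0]; linarith)
  have hL4 : 0 ≤ Real.log (4 / δ) := Real.log_nonneg (by rw [le_div_iff₀ hδ0]; linarith)
  have hX : (0 : ℝ) < transCount (treeDataset e D) x b (treeNext e x b s') := by
    exact_mod_cast hpos
  have hXn : (transCount (treeDataset e D) x b (treeNext e x b s') : ℝ) ≤
      visitCount (treeDataset e D) x b := by exact_mod_cast hle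
  have hemp := empKernel_mem (treeDataset e D) x b (treeNext e x b s')
  rw [abs_sub_comm]
  refine le_min ?_ (h2.trans (Real.sqrt_le_sqrt ?_))
  · refine (empirical_bernstein hemp
      (stdSimplex_apply_mem_Icc (treeKernel_mem e M.P_mem x b) _) (by positivity) h3).trans ?_
    rw [← mul_div_assoc, ← mul_div_assoc]
    have h5 : 0 ≤ 2 * empKernel (treeDataset e D) x b (treeNext e x b s') *
        (1 - empKernel (treeDataset e D) x b (treeNext e x b s')) * Real.log (4 / δ) :=
      mul_nonneg (mul_nonneg (by linarith [hemp.1]) (by linarith [hemp.2])) hL4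
    gcongr
  · gcongr

/-- One-step error at a vertex with two children, of which that above `s₁` has at least half of the
visits. -/
theorem one_step_error_of_major (h : M.StepEvent e δ D) (hδ0 : 0 < δ) (hδ1 : δ ≤ 1)
    {P' : TreeState A e → A → TreeState A e → ℝ}
    (hP' : P' ∈ confSet (treeDataset e D) (treeSucc e) δ) {V : TreeState A e → ℝ} {H : ℝ}
    (hV : ∀ x, V x ∈ Set.Icc 0 H) {x : TreeState A e} {b : A}
    (hn : 0 < visitCount (treeDataset e D) x b) {s₁ s₂ : S}
    (h₁ : IsBelow e x b s₁) (h₂ : IsBelow e x b s₂) (h12 : treeNext e x b s₁ ≠ treeNext e x b s₂)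
    (hmaj : visitCount (treeDataset e D) x b ≤
      2 * transCount (treeDataset e D) x b (treeNext e x b s₁)) :
    |∑ x', (P' x b x' - treeKernel e M.P x b x') * V x'| ≤
      5 * Real.sqrt (Real.log (4 / δ) / visitCount (treeDataset e D) x b *
        vecVar (treeKernel e M.P x b) V) +
        11 * (Real.log (4 / δ) / visitCount (treeDataset e D) x b) * H := by
  have hsupp : ∀ x', x' ≠ treeNext e x b s₁ → x' ≠ treeNext e x b s₂ → x' ∉ treeSucc e x b := by
    rintro x' h1 h2 ⟨s', h3, rfl⟩
    exact (treeNext_eq_or_of_isBelow h₁ h₂ h12 h3).elim h1 h2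
  have hL4 : 0 ≤ Real.log (4 / δ) := Real.log_nonneg (by rw [le_div_iff₀ hδ0]; linarith)
  obtain ⟨h1, -, h3⟩ := h.bounds h₁ hn
  have hX : 0 < transCount (treeDataset e D) x b (treeNext e x b s₁) := by omega
  have hemp := empKernel_mem (treeDataset e D) x b (treeNext e x b s₁)
  have hn' : (0 : ℝ) < visitCount (treeDataset e D) x b := by exact_mod_cast hn
  have hX' : (0 : ℝ) < transCount (treeDataset e D) x b (treeNext e x b s₁) := by exact_mod_cast hX
  refine abs_sum_sub_mul_le h12 (treeKernel_mem e M.P_mem x b) (hP' x b).1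
    (fun x' h1 h2 => treeKernel_eq_zero (hsupp x' h1 h2))
    (fun x' h1 h2 => (hP' x b).2.1 x' (hsupp x' h1 h2)) hV (by positivity) (by positivity) ?_
  refine abs_sub_le_of_confidence hemp
    (stdSimplex_apply_mem_Icc (treeKernel_mem e M.P_mem x b) _) (by positivity) h3 ?_
  refine ((hP' x b).2.2 _ hX).trans ((min_le_left _ _).trans ?_)
  have hnX : (visitCount (treeDataset e D) x b : ℝ) ≤
      2 * transCount (treeDataset e D) x b (treeNext e x b s₁) := by exact_mod_cast hmaj
  set n : ℝ := (visitCount (treeDataset e D) x b : ℝ)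
  set X : ℝ := (transCount (treeDataset e D) x b (treeNext e x b s₁) : ℝ)
  set p := empKernel (treeDataset e D) x b (treeNext e x b s₁)
  -- the frequent child has at least half of the visits, so its radius is of the order of the visits
  have hLX : Real.log (4 / δ) / X ≤ 2 * (Real.log (4 / δ) / n) := by
    rw [← mul_div_assoc, div_le_div_iff₀ hX' hn']
    nlinarith
  have hp : 0 ≤ p * (1 - p) := mul_nonneg hemp.1 (sub_nonneg.2 hemp.2)
  refine add_le_add (Real.sqrt_le_sqrt ?_) ?_
  · rw [mul_div_assoc]
    nlinarith
  · rw [mul_div_assoc]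
    linarith

/-- If all leaves below `x` have the same next vertex, there is no error at `x`. -/
theorem one_step_error_eq_zero {P' : TreeState A e → A → TreeState A e → ℝ}
    (hP' : P' ∈ confSet (treeDataset e D) (treeSucc e) δ) (V : TreeState A e → ℝ)
    {x : TreeState A e} {b : A} {s₁ : S}
    (hone : ∀ s', IsBelow e x b s' → treeNext e x b s' = treeNext e x b s₁) :
    ∑ x', (P' x b x' - treeKernel e M.P x b x') * V x' = 0 := by
  classical
  have hsupp : ∀ x', x' ≠ treeNext e x b s₁ → x' ∉ treeSucc e x b := by
    rintro x' h1 ⟨s', h3, rfl⟩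
    exact h1 (hone s' h3)
  have key : ∀ p : TreeState A e → ℝ, p ∈ stdSimplex ℝ _ → (∀ x', x' ∉ treeSucc e x b → p x' = 0) →
      p (treeNext e x b s₁) = 1 := by
    intro p hp h0
    rw [← hp.2, Finset.sum_eq_single (treeNext e x b s₁) (fun x' _ hx' => h0 x' (hsupp x' hx'))
      (by simp)]
  refine Finset.sum_eq_zero fun x' _ => ?_
  by_cases hx' : x' = treeNext e x b s₁
  · rw [hx', key _ (hP' x b).1 (hP' x b).2.1, key _ (treeKernel_mem e M.P_mem x b)
      (fun x' hx' => treeKernel_eq_zero hx'), sub_self, zero_mul]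
  · rw [(hP' x b).2.1 _ (hsupp x' hx'), treeKernel_eq_zero (hsupp x' hx'), sub_self, zero_mul]

/-- One-step error at any visited vertex. -/
theorem one_step_error (h : M.StepEvent e δ D) (hδ0 : 0 < δ) (hδ1 : δ ≤ 1)
    {P' : TreeState A e → A → TreeState A e → ℝ}
    (hP' : P' ∈ confSet (treeDataset e D) (treeSucc e) δ) {V : TreeState A e → ℝ} {H : ℝ}
    (hV : ∀ x, V x ∈ Set.Icc 0 H) {x : TreeState A e} {b : A}
    (hn : 0 < visitCount (treeDataset e D) x b) :
    |∑ x', (P' x b x' - treeKernel e M.P x b x') * V x'| ≤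
      5 * Real.sqrt (Real.log (4 / δ) / visitCount (treeDataset e D) x b *
        vecVar (treeKernel e M.P x b) V) +
        11 * (Real.log (4 / δ) / visitCount (treeDataset e D) x b) * H := by
  have hne : Nonempty S := by rcases x with s | ⟨s, _⟩ <;> exact ⟨s⟩
  obtain ⟨s₁, h₁⟩ := exists_isBelow e x b
  by_cases hone : ∀ s', IsBelow e x b s' → treeNext e x b s' = treeNext e x b s₁
  · have hL4 : 0 ≤ Real.log (4 / δ) := Real.log_nonneg (by rw [le_div_iff₀ hδ0]; linarith)
    have hH : 0 ≤ H := (hV x).1.trans (hV x).2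
    rw [one_step_error_eq_zero hP' V hone, abs_zero]
    positivity
  push Not at hone
  obtain ⟨s₂, h₂, h21⟩ := hone
  have htot : visitCount (treeDataset e D) x b =
      transCount (treeDataset e D) x b (treeNext e x b s₁) +
        transCount (treeDataset e D) x b (treeNext e x b s₂) := by
    classical
    rw [visitCount, ← Finset.sum_pair (f := fun x' => transCount (treeDataset e D) x b x') h21.symm]
    refine (Finset.sum_subset (Finset.subset_univ _) fun x' _ hx' => ?_).symm
    simp only [Finset.mem_insert, Finset.mem_singleton, not_or] at hx'
    refine transCount_treeDataset_eq_zero D ?_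
    rintro ⟨s', h3, rfl⟩
    exact (treeNext_eq_or_of_isBelow h₁ h₂ h21.symm h3).elim hx'.1 hx'.2
  rcases le_total (transCount (treeDataset e D) x b (treeNext e x b s₂))
    (transCount (treeDataset e D) x b (treeNext e x b s₁)) with hle | hle
  · exact one_step_error_of_major h hδ0 hδ1 hP' hV hn h₁ h₂ h21.symm (by omega)
  · exact one_step_error_of_major h hδ0 hδ1 hP' hV hn h₂ h₁ h21 (by omega)

end OneStep

/-! ### Accumulated errors -/

section Accumulated

variable {S A : Type*} [Fintype S] [Fintype A] {dim : ℕ} {M : SICMDP S A dim}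
  {e : S ≃ Fin (Fintype.card S)} {ν : S × A → ℝ} {δ : ℝ} {m : ℕ}

open Classical in
/-- Probability that one sample runs through the vertex `x`, in the tree in which one is when `b`
is played. -/
noncomputable def SICMDP.vertexProb (M : SICMDP S A dim) (ν : S × A → ℝ) (x : TreeState A e)
    (b : A) : ℝ :=
  ν (treeOrigin e x b) * ∑ s', if IsBelow e x b s' then
    M.P (treeOrigin e x b).1 (treeOrigin e x b).2 s' else 0

theorem SICMDP.vertexProb_eq {x : TreeState A e} {b : A} {s' : S} (hx : IsBelow e x b s') :
    M.vertexProb ν x b =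
      M.pathProb e ν (treeOrigin e x b).1 (treeOrigin e x b).2 (treeLevel e x) s' := by
  classical
  simp only [vertexProb, pathProb, massBelow, isBelow_iff hx]

/-- The one-step error in terms of the expected instead of the actual number of visits. Vertices
that are expected to be visited rarely have the trivial error `H`. -/
theorem one_step_error_of_vertexProb {D : Fin m → S × A × S} (h : M.StepEvent e δ D)
    (hvis : M.VisitEvent e ν δ D) (hδ0 : 0 < δ) (hδ1 : δ ≤ 1) (hm : 0 < m)
    {P' : TreeState A e → A → TreeState A e → ℝ}
    (hP' : P' ∈ confSet (treeDataset e D) (treeSucc e) δ) {V : TreeState A e → ℝ} {H : ℝ}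
    (hV : ∀ x, V x ∈ Set.Icc 0 H) {x : TreeState A e} {b : A} (hq : 0 < M.vertexProb ν x b) :
    |∑ x', (P' x b x' - treeKernel e M.P x b x') * V x'| ≤
      8 * Real.sqrt (Real.log (4 / δ) / (m * M.vertexProb ν x b) *
        vecVar (treeKernel e M.P x b) V) +
        22 * (Real.log (4 / δ) / (m * M.vertexProb ν x b)) * H := by
  have hne : Nonempty S := by rcases x with s | ⟨s, _⟩ <;> exact ⟨s⟩
  obtain ⟨s', hx⟩ := exists_isBelow e x b
  have hL4 : 0 < Real.log (4 / δ) := Real.log_pos (by rw [lt_div_iff₀ hδ0]; linarith)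
  have hm' : (0 : ℝ) < m := by exact_mod_cast hm
  have hmq : 0 < m * M.vertexProb ν x b := mul_pos hm' hq
  have hH : 0 ≤ H := (hV x).1.trans (hV x).2
  have hvar : 0 ≤ vecVar (treeKernel e M.P x b) V := vecVar_nonneg (treeKernel_mem e M.P_mem x b) V
  set θ := Real.log (4 / δ) / (m * M.vertexProb ν x b) with hθ
  have hθ0 : 0 < θ := by positivity
  -- in the first case there are at least `m * vertexProb / 2` visits
  rcases le_or_gt (8 * Real.log (4 / δ)) (m * M.vertexProb ν x b) with hc | hc
  · have h1 := hvis (treeOrigin e x b).1 (treeOrigin e x b).2 (treeLevel e x) s' (treeLevel_lt e x)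
    rw [← SICMDP.vertexProb_eq hx, ← visitCount_treeDataset D hx] at h1
    have h2 := h1 hc
    have hn' : (0 : ℝ) < visitCount (treeDataset e D) x b := by linarith
    have hn : 0 < visitCount (treeDataset e D) x b := by exact_mod_cast hn'
    have h3 : Real.log (4 / δ) / visitCount (treeDataset e D) x b ≤ 2 * θ := by
      rw [hθ, ← mul_div_assoc, div_le_div_iff₀ hn' hmq]
      nlinarith
    refine (one_step_error h hδ0 hδ1 hP' hV hn).trans (add_le_add ?_ ?_)
    · calc 5 * Real.sqrt (Real.log (4 / δ) / visitCount (treeDataset e D) x b *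
            vecVar (treeKernel e M.P x b) V)
          ≤ 5 * Real.sqrt (2 * (θ * vecVar (treeKernel e M.P x b) V)) := by
            rw [← mul_assoc]
            gcongr
        _ = 5 * Real.sqrt 2 * Real.sqrt (θ * vecVar (treeKernel e M.P x b) V) := by
            rw [Real.sqrt_mul two_pos.le, mul_assoc]
        _ ≤ _ := by
            refine mul_le_mul_of_nonneg_right ?_ (Real.sqrt_nonneg _)
            have : Real.sqrt 2 ≤ 8 / 5 := by
              rw [Real.sqrt_le_left (by norm_num)]
              norm_num
            linarith
    · exact mul_le_mul_of_nonneg_right (by linarith) hH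
  · have h1 : 1 ≤ 8 * θ := by
      rw [hθ, ← mul_div_assoc, le_div_iff₀ hmq]
      linarith
    have h2 := stdSimplex_avg_mem_Icc (hP' x b).1 hV
    have h3 := stdSimplex_avg_mem_Icc (treeKernel_mem e M.P_mem x b) hV
    have h4 : |∑ x', (P' x b x' - treeKernel e M.P x b x') * V x'| ≤ H := by
      simp_rw [sub_mul, Finset.sum_sub_distrib]
      rw [abs_le]
      constructor <;> linarith [h2.1, h2.2, h3.1, h3.2]
    have h5 := Real.sqrt_nonneg (θ * vecVar (treeKernel e M.P x b) V)
    nlinarith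

variable {π : TreeState A e → A → ℝ} {w : TreeState A e → ℝ}

theorem minProb_le {α : Type*} {ν : α → ℝ} {x : α} (hx : 0 < ν x) : minProb ν ≤ ν x :=
  csInf_le ⟨0, fun _ hp => hp.1.le⟩ ⟨hx, x, rfl⟩

theorem minProb_pos {α : Type*} [Finite α] {ν : α → ℝ} {x : α} (hx : 0 < ν x) :
    0 < minProb ν := by
  have h1 : {p | 0 < p ∧ ∃ x, ν x = p}.Finite :=
    (Set.finite_range ν).subset fun p hp => hp.2
  have h2 : {p | 0 < p ∧ ∃ x, ν x = p}.Nonempty := ⟨ν x, hx, x, rfl⟩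
  exact (h2.csInf_mem h1).1

theorem vertexProb_inl (s : S) (a : A) :
    M.vertexProb ν (Sum.inl s : TreeState A e) a = ν (s, a) := by
  have h : IsBelow e (Sum.inl s : TreeState A e) a s := by
    rw [← treePath_zero e s a s]
    exact isBelow_treePath e (treeDepth_pos S) s a s
  rw [SICMDP.vertexProb_eq h]
  change M.pathProb e ν s a 0 s = _
  rw [SICMDP.pathProb, massBelow_zero, (M.P_mem s a).2, mul_one]

/-- A vertex is visited at most as often as its tree is entered, times the conditional probability
that a path runs through it. -/
theorem occupancy_mul_le (hπ : IsPolicy π) (hw0 : ∀ x, 0 ≤ w x)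
    (hw : IsFlow (M.tree e).γ (M.tree e).μ (treeKernel e M.P) π w) (s : S) (a : A)
    (hν0 : 0 ≤ ν (s, a)) (q : InnerNode e) (b : A) :
    w (Sum.inr (s, a, q)) * ν (s, a) ≤
      w (Sum.inl s) * π (Sum.inl s) a * M.vertexProb ν (Sum.inr (s, a, q)) b := by
  obtain ⟨⟨k, j⟩, hk, s', hs'⟩ := q
  have hk' : 0 < (k : ℕ) ∧ (k : ℕ) < treeDepth S := ⟨hk, k.2⟩
  have hx : treePath e s a s' k = Sum.inr (s, a, ⟨(k, j), hk, s', hs'⟩) := by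
    rw [treePath_of_inner e hk']
    congr 3
    exact Subtype.ext (Prod.ext rfl (Fin.ext hs'))
  have h1 := vertexMass_eq hπ hw k.2 s a s'
  rw [vertexMass, if_neg hk'.1.ne', hx] at h1
  have h2 : M.vertexProb ν (Sum.inr (s, a, ⟨(k, j), hk, s', hs'⟩) : TreeState A e) b =
      ν (s, a) * massBelow e (M.P s a) k s' :=
    SICMDP.vertexProb_eq (by rw [← hx]; exact hx ▸ isBelow_treePath e k.2 s a s')
  have h3 : (M.tree e).γ ^ (k : ℕ) ≤ 1 :=
    pow_le_one₀ (M.tree e).γ_nonneg (M.tree e).γ_lt_one.le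
  have h4 : 0 ≤ w (Sum.inl s) * π (Sum.inl s) a * massBelow e (M.P s a) k s' * ν (s, a) :=
    mul_nonneg (mul_nonneg (mul_nonneg (hw0 _) ((hπ _).1 a))
      (massBelow_nonneg (M.P_mem s a).1 _ _)) hν0
  rw [h1, h2]
  nlinarith [mul_le_mul_of_nonneg_right h3 h4]

/-- The number of vertices of a tree, not the number of steps or actions, determines how much
the reciprocals of the visit probabilities add up to. -/
theorem sum_occupancy_div_le (hm : 0 < m) (hπ : IsPolicy π) (hν : ∀ x, 0 < ν x) (hw0 : ∀ x, 0 ≤ w x)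
    (hw : IsFlow (M.tree e).γ (M.tree e).μ (treeKernel e M.P) π w) {c : ℝ} (hc : 0 ≤ c) :
    ∑ x, ∑ b, w x * π x b * (c / (m * M.vertexProb ν x b)) ≤
      2 * Fintype.card S * c * (1 / (1 - (M.tree e).γ)) / (m * minProb ν) := by
  rcases isEmpty_or_nonempty S with hS | hS
  · rw [sum_treeState]
    simp
  have hm' : (0 : ℝ) < m := by exact_mod_cast hm
  have hA : Nonempty A := by
    by_contra hA
    rw [not_nonempty_iff] at hA
    simpa using (hπ (Sum.inl hS.some)).2
  have hν0 : 0 < minProb ν := minProb_pos (hν (hS.some, hA.some))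
  have hsum : ∑ s, w (Sum.inl s) ≤ 1 / (1 - (M.tree e).γ) := by
    rw [← hw.sum_eq (M.tree e).γ_lt_one (M.tree e).μ_mem (M.tree e).P_mem hπ,
      Fintype.sum_sum_type]
    exact le_add_of_nonneg_right (Finset.sum_nonneg fun z _ => hw0 _)
  have hcard : (Fintype.card (InnerNode e) : ℝ) + 1 ≤ 2 * Fintype.card S := by
    exact_mod_cast card_innerNode_add_one_le e
  have hroot : ∀ s a, 0 ≤ w (Sum.inl s) * π (Sum.inl s) a := fun s a =>
    mul_nonneg (hw0 _) ((hπ _).1 a)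
  have hvertex : ∀ s a (q : InnerNode e) b, w (Sum.inr (s, a, q)) *
      (c / (m * M.vertexProb ν (Sum.inr (s, a, q)) b)) ≤
        w (Sum.inl s) * π (Sum.inl s) a * (c / (m * minProb ν)) := by
    intro s a q b
    have h1 := occupancy_mul_le hπ hw0 hw s a (hν (s, a)).le q b
    set v := M.vertexProb ν (Sum.inr (s, a, q)) b with hv
    rcases le_or_gt v 0 with h0 | h0
    · have h2 : c / (m * v) ≤ 0 :=
        div_nonpos_of_nonneg_of_nonpos hc (mul_nonpos_of_nonneg_of_nonpos hm'.le h0)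
      exact (mul_nonpos_of_nonneg_of_nonpos (hw0 _) h2).trans
        (mul_nonneg (hroot s a) (by positivity))
    · have h2 : w (Sum.inr (s, a, q)) * minProb ν ≤ w (Sum.inl s) * π (Sum.inl s) a * v :=
        (mul_le_mul_of_nonneg_left (minProb_le (hν (s, a))) (hw0 _)).trans h1
      rw [← mul_div_assoc, ← mul_div_assoc, div_le_div_iff₀ (by positivity) (by positivity)]
      calc _ = c * m * (w (Sum.inr (s, a, q)) * minProb ν) := by ring
        _ ≤ c * m * (w (Sum.inl s) * π (Sum.inl s) a * v) := by gcongr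
        _ = _ := by ring
  rw [sum_treeState]
  calc _ ≤ ∑ s, ∑ a, 2 * Fintype.card S *
        (w (Sum.inl s) * π (Sum.inl s) a * (c / (m * minProb ν))) := by
        refine Finset.sum_le_sum fun s _ => Finset.sum_le_sum fun a _ => ?_
        have h1 : w (Sum.inl s) * π (Sum.inl s) a *
            (c / (m * M.vertexProb ν (Sum.inl s : TreeState A e) a)) ≤
            w (Sum.inl s) * π (Sum.inl s) a * (c / (m * minProb ν)) := by
          rw [vertexProb_inl]
          refine mul_le_mul_of_nonneg_left ?_ (hroot s a)
          have := minProb_le (hν (s, a))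
          gcongr
        have h2 : ∑ q, ∑ b, w (Sum.inr (s, a, q)) * π (Sum.inr (s, a, q)) b *
            (c / (m * M.vertexProb ν (Sum.inr (s, a, q)) b)) ≤
            ∑ q : InnerNode e, w (Sum.inl s) * π (Sum.inl s) a * (c / (m * minProb ν)) := by
          refine Finset.sum_le_sum fun q _ => ?_
          calc _ ≤ ∑ b, π (Sum.inr (s, a, q)) b *
                (w (Sum.inl s) * π (Sum.inl s) a * (c / (m * minProb ν))) := by
                refine Finset.sum_le_sum fun b _ => ?_
                rw [mul_comm (w _), mul_assoc]
                exact mul_le_mul_of_nonneg_left (hvertex s a q b) ((hπ _).1 b)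
            _ = _ := by rw [← Finset.sum_mul, (hπ _).2, one_mul]
        rw [Finset.sum_const, Finset.card_univ, nsmul_eq_mul] at h2
        refine (add_le_add h1 h2).trans ?_
        have h3 : 0 ≤ w (Sum.inl s) * π (Sum.inl s) a * (c / (m * minProb ν)) :=
          mul_nonneg (hroot s a) (by positivity)
        nlinarith [mul_le_mul_of_nonneg_right hcard h3]
    _ = 2 * Fintype.card S * (c / (m * minProb ν)) * ∑ s, w (Sum.inl s) := by
        rw [Finset.mul_sum]
        refine Finset.sum_congr rfl fun s _ => ?_
        rw [← Finset.mul_sum, ← Finset.sum_mul, ← Finset.mul_sum, (hπ _).2]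
        ring
    _ ≤ 2 * Fintype.card S * (c / (m * minProb ν)) * (1 / (1 - (M.tree e).γ)) := by gcongr
    _ = _ := by ring

/-- Resolution of the self-bounding inequality for the accumulated error `E`. -/
theorem le_of_self_bounding {E H Θ ε : ℝ} (hE0 : 0 ≤ E) (hΘ : 0 ≤ Θ) (hε : 0 < ε) (hεH : ε ≤ H)
    (hE : E ≤ 8 * Real.sqrt (Θ * (2 * H ^ 2 + 2 * H * E)) + 22 * H * Θ)
    (hsmall : 2500 * (Θ * H ^ 2) ≤ ε ^ 2) : E ≤ ε := by
  have hH : 0 < H := hε.trans_le hεH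
  set y := Real.sqrt Θ * H with hy
  have hy0 : 0 ≤ y := by positivity
  have hy2 : y ^ 2 = Θ * H ^ 2 := by rw [hy, mul_pow, Real.sq_sqrt hΘ]
  have h1 : 8 * Real.sqrt (Θ * (2 * H ^ 2 + 2 * H * E)) ≤ 12 * y + E / 2 + 64 * (Θ * H) := by
    have h2 : Real.sqrt (Θ * (2 * H ^ 2 + 2 * H * E)) ≤ (12 * y + E / 2 + 64 * (Θ * H)) / 8 := by
      have hTH : 0 ≤ Θ * H := by positivity
      rw [Real.sqrt_le_left (by positivity)]
      nlinarith [sq_nonneg (E / 2 - 64 * (Θ * H)), mul_nonneg hy0 hE0, mul_nonneg hy0 hTH]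
    linarith
  have h3 : y ≤ ε / 50 := by
    nlinarith
  have h4 : 2500 * (Θ * H) ≤ ε := by
    have : 2500 * (Θ * H) * H ≤ ε * H := by nlinarith
    exact le_of_mul_le_mul_right this hH
  nlinarith

/-- On the confidence events, the values of a policy under the true transition probabilities and
under any other transition probabilities in the optimistic set are close to each other. -/
theorem abs_value_sub_value_le_of_events {D : Fin m → S × A × S} (h : M.StepEvent e δ D)
    (hvis : M.VisitEvent e ν δ D) (hδ0 : 0 < δ) (hδ1 : δ ≤ 1) (hm : 0 < m)
    (hν : ∀ x, 0 < ν x) {P' : TreeState A e → A → TreeState A e → ℝ}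
    (hP' : P' ∈ confSet (treeDataset e D) (treeSucc e) δ) (hπ : IsPolicy π)
    {f : TreeState A e → A → ℝ} (hf : ∀ x b, f x b ∈ Set.Icc (0 : ℝ) 1) {ε : ℝ} (hε : 0 < ε)
    (hεH : ε ≤ 1 / (1 - (M.tree e).γ))
    (hsmall : 5000 * (Fintype.card S * Real.log (4 / δ) * (1 / (1 - (M.tree e).γ)) ^ 3) ≤
      m * minProb ν * ε ^ 2) :
    |(M.tree e).value (treeKernel e M.P) π f - (M.tree e).value P' π f| ≤ ε := by
  set H : ℝ := 1 / (1 - (M.tree e).γ) with hH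
  have hH0 : 0 < H := hε.trans_le hεH
  have hg0 := (M.tree e).γ_nonneg
  have hg1 := (M.tree e).γ_lt_one
  have hL4 : 0 < Real.log (4 / δ) := Real.log_pos (by rw [lt_div_iff₀ hδ0]; linarith)
  have hm' : (0 : ℝ) < m := by exact_mod_cast hm
  have hK := treeKernel_mem e M.P_mem
  obtain ⟨V, hVb, hV⟩ := exists_bellman hg0 hg1 (fun x b => (hP' x b).1) hπ hf
  obtain ⟨w, hw0, hw⟩ := exists_isFlow hg0 hg1 (M.tree e).μ_mem hK hπ
  have hne : Nonempty (TreeState A e) := by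
    by_contra hX
    rw [not_nonempty_iff] at hX
    simpa using (M.tree e).μ_mem.2
  have hS : Nonempty S := by rcases hne.some with s | ⟨s, _⟩ <;> exact ⟨s⟩
  have hA : Nonempty A := by
    by_contra hA
    rw [not_nonempty_iff] at hA
    simpa using (hπ hne.some).2
  have hν0 : 0 < minProb ν := minProb_pos (hν (hS.some, hA.some))
  refine ((M.tree e).abs_value_sub_value_le hK (fun x b => (hP' x b).1) hπ hf hw0 hw hVb hV).trans
    ?_
  have hvar := sum_vecVar_le hg0 hg1 (M.tree e).μ_mem hK (fun x b => (hP' x b).1) hπ hf hw0 hw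
    hVb hV
  have hΘle := sum_occupancy_div_le hm hπ hν hw0 hw hL4.le
  rw [← hH] at hvar hΘle hVb
  set err : TreeState A e → A → ℝ := fun x b =>
    (M.tree e).γ * |∑ x', (P' x b x' - treeKernel e M.P x b x') * V x'| with herr
  set θ : TreeState A e → A → ℝ := fun x b => Real.log (4 / δ) / (m * M.vertexProb ν x b) with hθ
  set v : TreeState A e → A → ℝ := fun x b =>
    (M.tree e).γ ^ 2 * vecVar (treeKernel e M.P x b) V with hv
  have hρ : ∀ x b, 0 ≤ w x * π x b := fun x b => mul_nonneg (hw0 x) ((hπ x).1 b)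
  have hv0 : ∀ x b, 0 ≤ v x b := fun x b => mul_nonneg (sq_nonneg _) (vecVar_nonneg (hK x b) V)
  have hq0 : ∀ (x : TreeState A e) b, 0 ≤ M.vertexProb ν x b := by
    intro x b
    refine mul_nonneg (hν _).le (Finset.sum_nonneg fun s' _ => ?_)
    split_ifs
    · exact (M.P_mem _ _).1 _
    · exact le_rfl
  have hθ0 : ∀ x b, 0 ≤ θ x b := fun x b =>
    div_nonneg hL4.le (mul_nonneg hm'.le (hq0 x b))
  have hstep : ∀ x b, w x * π x b * err x b ≤
      8 * (Real.sqrt (w x * π x b * θ x b) * Real.sqrt (w x * π x b * v x b)) +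
        22 * H * (w x * π x b * θ x b) := by
    intro x b
    rcases (hq0 x b).eq_or_lt with hq | hq
    · -- a vertex of probability zero is never visited
      have hwx : w x * π x b = 0 := by
        rcases x with s | ⟨s, a, q⟩
        · rw [vertexProb_inl] at hq
          exact absurd hq (hν _).ne
        · have h1 := occupancy_mul_le hπ hw0 hw s a (hν (s, a)).le q b
          rw [← hq, mul_zero] at h1
          have h2 : w (Sum.inr (s, a, q)) = 0 :=
            le_antisymm (nonpos_of_mul_nonpos_left h1 (hν _)) (hw0 _)
          rw [h2, zero_mul]
      simp [hwx]
    · have h1 := one_step_error_of_vertexProb h hvis hδ0 hδ1 hm hP' hVb hq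
      have h2 : err x b ≤ 8 * Real.sqrt (θ x b * v x b) + 22 * H * θ x b := by
        have h3 : Real.sqrt (θ x b * v x b) = (M.tree e).γ *
            Real.sqrt (θ x b * vecVar (treeKernel e M.P x b) V) := by
          rw [show θ x b * v x b = (M.tree e).γ ^ 2 * (θ x b * vecVar (treeKernel e M.P x b) V) by
            simp only [hv]; ring, Real.sqrt_mul (sq_nonneg _), Real.sqrt_sq hg0]
        have h4 : (M.tree e).γ * (22 * θ x b * H) ≤ 22 * θ x b * H :=
          mul_le_of_le_one_left (by have := hθ0 x b; positivity) hg1.le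
        have h5 := mul_le_mul_of_nonneg_left h1 hg0
        rw [h3]
        simp only [herr]
        simp only [hθ] at h4 h5 ⊢
        linarith
      have h3 : Real.sqrt (w x * π x b * θ x b) * Real.sqrt (w x * π x b * v x b) =
          w x * π x b * Real.sqrt (θ x b * v x b) := by
        rw [← Real.sqrt_mul (mul_nonneg (hρ x b) (hθ0 x b)),
          show w x * π x b * θ x b * (w x * π x b * v x b) =
            (w x * π x b) ^ 2 * (θ x b * v x b) by ring,
          Real.sqrt_mul (sq_nonneg _), Real.sqrt_sq (hρ x b)]
      rw [h3]
      have h4 := mul_le_mul_of_nonneg_left h2 (hρ x b)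
      linarith
  set E := ∑ x, ∑ b, w x * π x b * err x b with hE
  set Θ := ∑ x, ∑ b, w x * π x b * θ x b with hΘ
  have hΘ0 : 0 ≤ Θ := Finset.sum_nonneg fun x _ => Finset.sum_nonneg fun b _ =>
    mul_nonneg (hρ x b) (hθ0 x b)
  have hE0 : 0 ≤ E := Finset.sum_nonneg fun x _ => Finset.sum_nonneg fun b _ =>
    mul_nonneg (hρ x b) (mul_nonneg hg0 (abs_nonneg _))
  refine le_of_self_bounding hE0 hΘ0 hε hεH ?_ ?_
  · -- Cauchy–Schwarz inequality over all pairs of a vertex and an action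
    have hCS : ∑ x, ∑ b, Real.sqrt (w x * π x b * θ x b) * Real.sqrt (w x * π x b * v x b) ≤
        Real.sqrt (Θ * (2 * H ^ 2 + 2 * H * E)) := by
      have h1 := Real.sum_sqrt_mul_sqrt_le (Finset.univ : Finset (TreeState A e × A))
        (f := fun z => w z.1 * π z.1 z.2 * θ z.1 z.2) (g := fun z => w z.1 * π z.1 z.2 * v z.1 z.2)
        (fun z => mul_nonneg (hρ _ _) (hθ0 _ _)) (fun z => mul_nonneg (hρ _ _) (hv0 _ _))
      simp only [Fintype.sum_prod_type] at h1
      rw [Real.sqrt_mul hΘ0]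
      exact h1.trans (mul_le_mul_of_nonneg_left (Real.sqrt_le_sqrt hvar) (Real.sqrt_nonneg _))
    calc E ≤ ∑ x, ∑ b, (8 * (Real.sqrt (w x * π x b * θ x b) * Real.sqrt (w x * π x b * v x b)) +
          22 * H * (w x * π x b * θ x b)) :=
          Finset.sum_le_sum fun x _ => Finset.sum_le_sum fun b _ => hstep x b
      _ = 8 * ∑ x, ∑ b, Real.sqrt (w x * π x b * θ x b) * Real.sqrt (w x * π x b * v x b) +
          22 * H * Θ := by
          simp_rw [hΘ, Finset.mul_sum, ← Finset.sum_add_distrib]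
      _ ≤ _ := by linarith
  · calc 2500 * (Θ * H ^ 2)
        ≤ 2500 * (2 * Fintype.card S * Real.log (4 / δ) * H / (m * minProb ν) * H ^ 2) := by
          gcongr
      _ = 5000 * (Fintype.card S * Real.log (4 / δ) * H ^ 3) / (m * minProb ν) := by ring
      _ ≤ ε ^ 2 := by
          rw [div_le_iff₀ (by positivity)]
          linarith

end Accumulated

/-! ### Sample complexity -/

section SampleComplexity

variable {S A : Type*} [Fintype S] [Fintype A] {dim : ℕ}

theorem SICMDP.value_mem_Icc (M : SICMDP S A dim) {K : S → A → S → ℝ}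
    (hK : ∀ s a, K s a ∈ stdSimplex ℝ S) {π : S → A → ℝ} (hπ : IsPolicy π) {f : S → A → ℝ}
    (hf : ∀ s a, f s a ∈ Set.Icc (0 : ℝ) 1) : M.value K π f ∈ Set.Icc 0 (1 / (1 - M.γ)) := by
  obtain ⟨V, hVb, hV⟩ := exists_bellman M.γ_nonneg M.γ_lt_one hK hπ hf
  rw [M.value_eq_of_bellman hK hπ (fun x b => (hf x b).1) hVb hV]
  exact stdSimplex_avg_mem_Icc M.μ_mem hVb

theorem treeDepth_le_three_mul_log (hS : 2 ≤ Fintype.card S) :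
    (treeDepth S : ℝ) ≤ 3 * Real.log (Fintype.card S) := by
  have hne : Nonempty S := Fintype.card_pos_iff.1 (by omega)
  have h1 : 2 ^ treeDepth S ≤ Fintype.card S ^ 2 := by
    have := two_pow_treeDepth_le S
    nlinarith
  have h2 : ((2 : ℝ) ^ treeDepth S) ≤ (Fintype.card S : ℝ) ^ 2 := by exact_mod_cast h1
  have h3 := Real.log_le_log (by positivity) h2
  rw [Real.log_pow, Real.log_pow] at h3
  have h4 := Real.log_two_gt_d9
  have h5 : (0 : ℝ) ≤ treeDepth S := Nat.cast_nonneg _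
  push_cast at h3
  nlinarith

variable {M : SICMDP S A dim} {e : S ≃ Fin (Fintype.card S)}

/-- With a single state there is nothing to learn. -/
theorem eq_treeKernel_of_subsingleton [Subsingleton S] {δ : ℝ} {m : ℕ} {D : Fin m → S × A × S}
    {P' : TreeState A e → A → TreeState A e → ℝ}
    (hP' : P' ∈ confSet (treeDataset e D) (treeSucc e) δ) : P' = treeKernel e M.P := by
  classical
  funext x b x'
  have hne : Nonempty S := by rcases x with s | ⟨s, _⟩ <;> exact ⟨s⟩
  have h1 := one_step_error_eq_zero (M := M) hP' (Pi.single x' 1) (x := x) (b := b)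
    (s₁ := hne.some) (fun s' _ => by rw [Subsingleton.elim s' hne.some])
  simp only [Pi.single_apply, mul_ite, mul_one, mul_zero, Finset.sum_ite_eq', Finset.mem_univ,
    if_true] at h1
  linarith

/-- Optimism: if the true transition probabilities belong to the optimistic set and no member of
that set misjudges the value of a policy by more than `ε`, the returned policy is good. -/
theorem SICMDP.IsModifiedSICRL.good {δ ε : ℝ} {m : ℕ} {alg : (Fin m → S × A × S) → S → A → ℝ}
    (halg : M.IsModifiedSICRL e δ alg) {πopt : S → A → ℝ} (hopt : M.IsOptimalPolicy πopt)
    {D : Fin m → S × A × S}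
    (htrue : treeKernel e M.P ∈ confSet (treeDataset e D) (treeSucc e) δ)
    (hclose : ∀ P' ∈ confSet (treeDataset e D) (treeSucc e) δ, ∀ π, IsPolicy π →
      ∀ f : TreeState A e → A → ℝ, (∀ x b, f x b ∈ Set.Icc (0 : ℝ) 1) →
        |(M.tree e).value (treeKernel e M.P) π f - (M.tree e).value P' π f| ≤ ε) :
    M.value M.P πopt M.r - M.value M.P (alg D) M.r ≤ ε ∧
      ∀ y ∈ M.Y, M.value M.P (alg D) (M.c y) - M.u y ≤ ε := by
  -- the optimal policy of `M`, with arbitrary actions in the added states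
  set πbar : TreeState A e → A → ℝ := Sum.elim πopt (fun z => πopt z.1) with hπbar
  have hπbar_pol : IsPolicy πbar := by
    rintro (s | z)
    · exact hopt.1.1 s
    · exact hopt.1.1 z.1
  have hfeas : (M.tree e).OptimisticFeasible (treeDataset e D) (treeSucc e) δ
      (treeKernel e M.P) πbar :=
    ⟨htrue, hπbar_pol, fun y hy =>
      (value_tree M hπbar_pol (M.c_mem y hy)).trans_le (hopt.1.2 y hy)⟩
  obtain ⟨P', π, ⟨⟨hP', hπ, hcon⟩, hmax⟩, hrestr⟩ := (halg D).2 ⟨_, _, hfeas⟩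
  have halgD : alg D = fun s => π (Sum.inl s) := funext hrestr
  rw [halgD]
  constructor
  · rw [← value_tree (e := e) M hπ M.r_mem]
    have h1 : M.value M.P πopt M.r = (M.tree e).value (treeKernel e M.P) πbar (M.tree e).r :=
      (value_tree M hπbar_pol M.r_mem).symm
    have h2 := hmax _ _ hfeas
    have h3 := (abs_le.1 (hclose P' hP' π hπ _ (M.tree e).r_mem)).1
    change _ - (M.tree e).value (treeKernel e M.P) π (M.tree e).r ≤ ε
    linarith
  · intro y hy
    rw [← value_tree (e := e) M hπ (M.c_mem y hy)]
    have h2 := hcon y hy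
    have h3 := (abs_le.1 (hclose P' hP' π hπ _ ((M.tree e).c_mem y hy))).2
    change (M.tree e).value (treeKernel e M.P) π ((M.tree e).c y) - (M.tree e).u y ≤ ε
    linarith

end SampleComplexity

theorem mainTheorem3 :
    ∃ C : ℝ, 0 < C ∧
      ∀ (S A : Type*) [Fintype S] [Fintype A] (dim : ℕ) (M : SICMDP S A dim)
        (e : S ≃ Fin (Fintype.card S)) (πopt : S → A → ℝ) (ν : S × A → ℝ) (ε δ : ℝ) (m : ℕ)
        (alg : (Fin m → S × A × S) → S → A → ℝ),
        M.IsOptimalPolicy πopt →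
        ν ∈ stdSimplex ℝ (S × A) →
        (∀ x, 0 < ν x) →
        0 < ε →
        0 < δ →
        C * ((Fintype.card S : ℝ) * Fintype.card A * Real.log (Fintype.card S) ^ 3 *
            Real.log (8 * (Fintype.card S : ℝ) ^ 4 * (Fintype.card A : ℝ) ^ 3 / δ) /
          (minProb ν * ε ^ 2 * (1 - M.γ) ^ 3)) ≤ m →
        M.IsModifiedSICRL e (δ / (2 * (Fintype.card S : ℝ) ^ 4 * (Fintype.card A : ℝ) ^ 3)) alg →
        M.IsPACOptimal πopt ν ε δ alg := by
  -- `135000 = 5000 * 3 ^ 3`, where `3` compares the depth of the trees with `log |S|`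
  refine ⟨135000, by norm_num, ?_⟩
  intro S A _ _ dim M e πopt ν ε δ m alg hopt hν hνpos hε hδ hm halg
  rcases le_or_gt 1 δ with hδ1 | hδ1
  · exact (sub_nonpos.2 hδ1).trans (iidProb_nonneg (M.sampleWeight_nonneg hν) _)
  have hne : Nonempty (S × A) := by
    by_contra h
    rw [not_nonempty_iff] at h
    simpa using hν.2
  have hcS : (1 : ℝ) ≤ Fintype.card S := by
    have : Nonempty S := ⟨hne.some.1⟩
    exact_mod_cast Fintype.card_pos (α := S)
  have hcA : (1 : ℝ) ≤ Fintype.card A := by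
    have : Nonempty A := ⟨hne.some.2⟩
    exact_mod_cast Fintype.card_pos (α := A)
  refine M.one_sub_le_datasetProb e hν hδ hδ1 fun D hstep hvis => ?_
  set δ' := δ / (2 * (Fintype.card S : ℝ) ^ 4 * (Fintype.card A : ℝ) ^ 3) with hδ'
  have hδ'0 : 0 < δ' := by positivity
  have hδ'1 : δ' ≤ 1 := by
    rw [hδ', div_le_one (by positivity)]
    have h1 := one_le_pow₀ hcS (n := 4)
    have h2 := one_le_pow₀ hcA (n := 3)
    nlinarith
  refine halg.good hopt (hstep.treeKernel_mem_confSet hδ'0 hδ'1) fun P' hP' π hπ f hf => ?_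
  rcases lt_or_ge (Fintype.card S) 2 with hS | hS
  · have : Subsingleton S := Fintype.card_le_one_iff_subsingleton.1 (by omega)
    rw [eq_treeKernel_of_subsingleton (M := M) hP', sub_self, abs_zero]
    exact hε.le
  rcases lt_or_ge (1 / (1 - (M.tree e).γ)) ε with hεH | hεH
  · have h1 := (M.tree e).value_mem_Icc (treeKernel_mem e M.P_mem) hπ hf
    have h2 := (M.tree e).value_mem_Icc (fun x b => (hP' x b).1) hπ hf
    rw [abs_le]
    constructor <;> linarith [h1.1, h1.2, h2.1, h2.2]
  have hL : Real.log (8 * (Fintype.card S : ℝ) ^ 4 * (Fintype.card A : ℝ) ^ 3 / δ) =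
      Real.log (4 / δ') := by
    congr 1
    rw [hδ']
    field_simp
    ring
  have hL4 : 0 < Real.log (4 / δ') := Real.log_pos (by rw [lt_div_iff₀ hδ'0]; linarith)
  rw [hL] at hm
  have hg : 0 < 1 - M.γ := sub_pos.2 M.γ_lt_one
  have hν0 : 0 < minProb ν := minProb_pos (hνpos hne.some)
  have hlog : 0 < Real.log (Fintype.card S) := Real.log_pos (by exact_mod_cast hS)
  have hm0 : 0 < m := by
    have : (0 : ℝ) < m := lt_of_lt_of_le (by positivity) hm
    exact_mod_cast this
  refine abs_value_sub_value_le_of_events hstep hvis hδ'0 hδ'1 hm0 hνpos hP' hπ hf hε hεH ?_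
  set H := 1 / (1 - (M.tree e).γ) with hH
  have hH0 : 0 < H := hε.trans_le hεH
  have hHle : H ≤ 3 * Real.log (Fintype.card S) / (1 - M.γ) :=
    (tree_horizon_le M).trans
      (div_le_div_of_nonneg_right (treeDepth_le_three_mul_log hS) hg.le)
  calc 5000 * (Fintype.card S * Real.log (4 / δ') * H ^ 3)
      ≤ 5000 * (Fintype.card S * Fintype.card A * Real.log (4 / δ') *
          (3 * Real.log (Fintype.card S) / (1 - M.γ)) ^ 3) := by
        gcongr
        exact le_mul_of_one_le_right (by positivity) hcA
    _ = 135000 * ((Fintype.card S : ℝ) * Fintype.card A * Real.log (Fintype.card S) ^ 3 *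
          Real.log (4 / δ') / (minProb ν * ε ^ 2 * (1 - M.γ) ^ 3)) * (minProb ν * ε ^ 2) := by
        field_simp
        ring
    _ ≤ m * (minProb ν * ε ^ 2) := mul_le_mul_of_nonneg_right hm (by positivity)
    _ = m * minProb ν * ε ^ 2 := by ring
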